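/- Let $\mathfrak H=\{\tau\in\mathbf C:\operatorname{Im}\tau>0\}$, put $q=e^{2\pi i\tau}$ and $q^{s}=e^{2\pi i s\tau}$, and let ${}'$ denote $q\,\frac{d}{dq}=\frac1{2\pi i}\frac{d}{d\tau}$. Define on $\mathfrak H$ the theta-nulls $$\vartheta_2=\sum_{m\in\mathbf Z}q^{(m+\frac12)^2},\qquad \vartheta_3=\sum_{m\in\mathbf Z}q^{m^2},\qquad \vartheta_4=\sum_{m\in\mathbf Z}(-1)^mq^{m^2},$$ and the function $$\hat K\hat E=1+8\sum_{n=1}^\infty\frac{q^{2n}}{(1+q^{2n})^2}.$$ For $0<\alpha<1$ let $$\mathsf K(\alpha)=\tfrac12\int_0^1x^{-1/2}(1-x)^{-1/2}(1-\alpha x)^{-1/2}\,dx,\qquad \mathsf E(\alpha)=\tfrac12\int_0^1x^{-1/2}(1-x)^{-1/2}(1-\alpha x)^{1/2}\,dx$$ be the complete elliptic integrals, and let $\hat{\mathsf K}=\mathsf K/(\pi/2)$, $\hat{\mathsf E}=\mathsf E/(\pi/2)$. Then $\vartheta_2,\vartheta_3,\vartheta_4,\hat K\hat E$ are holomorphic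 on $\mathfrak H$, and $\vartheta_2,\vartheta_3,\vartheta_4$ have no zeros there. The function $\hat K\hat E$ is the product of the normalized complete elliptic integrals regarded as a function of the nome: for every $0<\alpha<1$, its value at the point $\tau=\dfrac{i\,\mathsf K(1-\alpha)}{2\,\mathsf K(\alpha)}$ of $\mathfrak H$ (that is, at $q=e^{-\pi\mathsf K(1-\alpha)/\mathsf K(\alpha)}$) is $\hat{\mathsf K}(\alpha)\,\hat{\mathsf E}(\alpha)$. Moreover, the following differential system holds on $\mathfrak H$: $$\frac{4\vartheta_2'}{\vartheta_2}=\hat K\hat E,\qquad \frac{4\vartheta_3'}{\vartheta_3}=\hat K\hat E-\vartheta_4^4,\qquad \frac{4\vartheta_4'}{\vartheta_4}=\hat K\hat E-\vartheta_3^4,\qquad 2(\hat K\hat E)'=(\hat K\hat E)^2-\vartheta_3^4\vartheta_4^4.$$ -/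

import Mathlib

open Complex
open scoped Manifold

noncomputable section

namespace ThetaKE

/-- `q = exp (2 π i τ)`. -/
def q (τ : UpperHalfPlane) : ℂ := cexp (2 * Real.pi * I * τ)

/-- `ϑ₂ = ∑ q ^ ((m + 1/2) ^ 2)` over the integers `m`, where `q ^ s` means `exp (2 π i s τ)`. -/
def theta2 (τ : UpperHalfPlane) : ℂ :=
  ∑' m : ℤ, cexp (2 * Real.pi * I * ((m : ℂ) + 1 / 2) ^ 2 * τ)

/-- `ϑ₃ = ∑ q ^ (m ^ 2)` over the integers `m`. -/
def theta3 (τ : UpperHalfPlane) : ℂ :=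
  ∑' m : ℤ, q τ ^ (m ^ 2)

/-- `ϑ₄ = ∑ (-1) ^ m q ^ (m ^ 2)` over the integers `m`. -/
def theta4 (τ : UpperHalfPlane) : ℂ :=
  ∑' m : ℤ, (-1 : ℂ) ^ m * q τ ^ (m ^ 2)

/-- The first complete elliptic integral, as a function of the parameter `α = k ^ 2`. -/
def ellipticK (α : ℝ) : ℝ :=
  (1 / 2) * ∫ x in (0 : ℝ)..1,
    x ^ (-(1 / 2) : ℝ) * (1 - x) ^ (-(1 / 2) : ℝ) * (1 - α * x) ^ (-(1 / 2) : ℝ)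

/-- The second complete elliptic integral, as a function of the parameter `α = k ^ 2`. -/
def ellipticE (α : ℝ) : ℝ :=
  (1 / 2) * ∫ x in (0 : ℝ)..1,
    x ^ (-(1 / 2) : ℝ) * (1 - x) ^ (-(1 / 2) : ℝ) * (1 - α * x) ^ ((1 / 2) : ℝ)

/-- `K / (π / 2)`. -/
def normK (α : ℝ) : ℝ := ellipticK α / (Real.pi / 2)

/-- `E / (π / 2)`. -/
def normE (α : ℝ) : ℝ := ellipticE α / (Real.pi / 2)

/-- The function `1 + 8 ∑_{n ≥ 1} q ^ (2 n) / (1 + q ^ (2 n)) ^ 2` on the upper half-plane. That it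
is the product of the two normalized complete elliptic integrals, regarded as a function of the
nome, is asserted (not assumed) wherever this is used. -/
def KE (τ : UpperHalfPlane) : ℂ :=
  1 + 8 * ∑' n : ℕ+, q τ ^ (2 * (n : ℕ)) / (1 + q τ ^ (2 * (n : ℕ))) ^ 2

/-- The derivation `' = q d/dq = (2 π i)⁻¹ d/dτ`. -/
abbrev qderiv (f : UpperHalfPlane → ℂ) : UpperHalfPlane → ℂ :=
  Derivative.normalizedDerivOfComplex f

end ThetaKE

end

/-!
The proof works with the theta constants `θ₂, θ₃, θ₄` as functions of the classical modular
variable `t = 2 τ`, in which the nome is `exp (π i t)` and the derivation is `D = (π i)⁻¹ d/dt`.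
Put `P = 4 D θ₂ / θ₂`.

*Duplication.* Splitting the lattice of pairs of integers by the parity of the sum
(`jacobiTheta₂_mul`) gives the formulas that express `θ₃² ± θ₄²`, `θ₃ θ₄` and `θ₂²` at `t` through
theta constants at `2 t`. They imply Jacobi's identity `θ₂⁴ + θ₄⁴ = θ₃⁴` and the absence of zeros,
since a zero at `t` would propagate to all `2 ^ n t` and so to the cusp. They also show that
`4 (D θ₂ / θ₂ - D θ₃ / θ₃) / θ₄⁴` is invariant under `t ↦ 2 t`; it tends to `1` at the cusp, so it
is `1` (`thetaLog_th2_sub_th3`). Similarly the defect `R = 2 D P - P² + θ₃⁴ θ₄⁴` satisfies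
`R(t) = 4 R(2 t)` and decays exponentially at the cusp, so it vanishes
(`riccatiDefect_eq_zero`). This is the whole differential system, with `P` in the place of `KE`.

*The Lambert series.* `(θ₂ θ₃ θ₄) ^ 8` is a cusp form of level one and weight twelve, hence a
multiple of `η ^ 24`. Comparing logarithmic derivatives gives `E₂ = 3 P - θ₃⁴ - θ₄⁴`, and with the
duplication formula for `P` this becomes `3 P(t) = 4 E₂(2 t) - E₂(t)`, whose `q`-expansion is that
of `3 KE` (`KE_eq_thetaLog`).

*Elliptic integrals.* On the imaginary axis `t = i s` let `α = θ₂⁴ / θ₃⁴`. By the differential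
system, `(θ₃², P / θ₃²)` solves the same linear system of rank two in `s` as `(K(α), E(α))`. The
Wronskian is constant and vanishes at the cusp, so the two solutions are proportional, and the
value at the cusp gives `K(α) = (π / 2) θ₃²` and `E(α) = (π / 2) P / θ₃²`, whence `KE = P` is the
product of the normalized integrals. The inversion `s ↦ 1 / s` exchanges `α` and `1 - α`, which
identifies `s` as `K(1 - α) / K(α)`, and by the intermediate value theorem every `α` in `(0, 1)`
occurs.
-/

namespace ThetaKE

open Filter Topology

noncomputable section

/-! ### Theta constants in the modular variable -/

/-- The theta constant `θ₂ = ∑ exp (π i (n + 1/2) ^ 2 t)`, with the factor `exp (π i t / 4)` split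
off. -/
def th2 (t : ℂ) : ℂ := cexp (Real.pi * I * t / 4) * jacobiTheta₂ (t / 2) t

/-- The theta constant `θ₃ = ∑ exp (π i n ^ 2 t)`. -/
def th3 (t : ℂ) : ℂ := jacobiTheta₂ 0 t

/-- The theta constant `θ₄ = ∑ (-1) ^ n exp (π i n ^ 2 t)`. -/
def th4 (t : ℂ) : ℂ := jacobiTheta₂ (1 / 2) t

/-- The pairs of integers `(m, n)` are those with `m + n` even, `(a + b, a - b)`, and those with
`m + n` odd, `(a + b + 1, a - b)`. -/
def parityEquiv : (ℤ × ℤ) ⊕ (ℤ × ℤ) ≃ ℤ × ℤ where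
  toFun := Sum.elim (fun p => (p.1 + p.2, p.1 - p.2)) (fun p => (p.1 + p.2 + 1, p.1 - p.2))
  invFun p := if (p.1 + p.2) % 2 = 0 then .inl ((p.1 + p.2) / 2, (p.1 - p.2) / 2)
    else .inr ((p.1 + p.2 - 1) / 2, (p.1 - p.2 - 1) / 2)
  left_inv := by
    rintro (⟨a, b⟩ | ⟨a, b⟩)
    · have h : (a + b + (a - b)) % 2 = 0 := by omega
      simp only [Sum.elim_inl, h, if_true, Sum.inl.injEq, Prod.mk.injEq]
      omega
    · have h : ¬ (a + b + 1 + (a - b)) % 2 = 0 := by omega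
      simp only [Sum.elim_inr, h, if_false, Sum.inr.injEq, Prod.mk.injEq]
      omega
  right_inv := by
    rintro ⟨m, n⟩
    dsimp only
    split_ifs with h
    · simp only [Sum.elim_inl, Prod.mk.injEq]; omega
    · simp only [Sum.elim_inr, Prod.mk.injEq]; omega

lemma im_two_mul_pos {t : ℂ} (ht : 0 < t.im) : 0 < (2 * t).im := by
  simpa using ht

/-- Summing over the sublattice of pairs of integers of even sum, and over its other coset,
expresses a product of two theta functions through theta functions of twice the modular variable.
All duplication formulas below are special values. -/
lemma jacobiTheta₂_mul (z w : ℂ) {t : ℂ} (ht : 0 < t.im) :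
    jacobiTheta₂ z t * jacobiTheta₂ w t =
      jacobiTheta₂ (z + w) (2 * t) * jacobiTheta₂ (z - w) (2 * t) +
        cexp (2 * Real.pi * I * z + Real.pi * I * t) *
          (jacobiTheta₂ (z + w + t) (2 * t) * jacobiTheta₂ (z - w + t) (2 * t)) := by
  have hs (x s : ℂ) (h : 0 < s.im) : Summable fun n => ‖jacobiTheta₂_term n x s‖ :=
    ((summable_jacobiTheta₂_term_iff x s).mpr h).norm
  have h2 := im_two_mul_pos ht
  have hA := summable_mul_of_summable_norm (hs z t ht) (hs w t ht)
  have hB := summable_mul_of_summable_norm (hs (z + w) _ h2) (hs (z - w) _ h2)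
  have hC := summable_mul_of_summable_norm (hs (z + w + t) _ h2) (hs (z - w + t) _ h2)
  simp only [jacobiTheta₂]
  rw [tsum_mul_tsum_of_summable_norm (hs _ _ ht) (hs _ _ ht),
    tsum_mul_tsum_of_summable_norm (hs _ _ h2) (hs _ _ h2),
    tsum_mul_tsum_of_summable_norm (hs _ _ h2) (hs _ _ h2), ← tsum_mul_left]
  have hA' := parityEquiv.summable_iff.mpr hA
  refine (parityEquiv.tsum_eq _).symm.trans ((Summable.tsum_sum
    (hA'.comp_injective Sum.inl_injective) (hA'.comp_injective Sum.inr_injective)).trans ?_)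
  congr 1
  · refine tsum_congr fun p => ?_
    simp only [parityEquiv, Function.comp_apply, Equiv.coe_fn_mk, Sum.elim_inl,
      jacobiTheta₂_term, ← Complex.exp_add]
    congr 1
    push_cast
    ring
  · refine tsum_congr fun p => ?_
    simp only [parityEquiv, Function.comp_apply, Equiv.coe_fn_mk, Sum.elim_inr,
      jacobiTheta₂_term, ← Complex.exp_add]
    congr 1
    push_cast
    ring

/-- The theta function vanishes at the half period `1/2 + t`, for the lattice of periods `1`, `2 t`:
there it is odd. -/
lemma jacobiTheta₂_half_add (t : ℂ) : jacobiTheta₂ (1 / 2 + t) (2 * t) = 0 := by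
  have h1 := jacobiTheta₂_add_left' (-(1 / 2) - t) (2 * t)
  have h2 := jacobiTheta₂_neg_left (1 / 2 + t) (2 * t)
  have h3 := jacobiTheta₂_add_left (-(1 / 2) + t) (2 * t)
  rw [show -(1 / 2) - t + 2 * t = -(1 / 2) + t by ring,
    show -Real.pi * I * (2 * t + 2 * (-(1 / 2) - t)) = Real.pi * I by ring, Complex.exp_pi_mul_I,
    show -(1 / 2) - t = -(1 / 2 + t) by ring, h2] at h1
  rw [show -(1 / 2) + t + 1 = 1 / 2 + t by ring, h1] at h3
  have : 2 * jacobiTheta₂ (1 / 2 + t) (2 * t) = 0 := by linear_combination h3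
  simpa using this

lemma th2_two_mul_sq (t : ℂ) :
    th2 (2 * t) ^ 2 = cexp (Real.pi * I * t) * jacobiTheta₂ t (2 * t) ^ 2 := by
  rw [th2, mul_pow, ← Complex.exp_nat_mul, show 2 * t / 2 = t by ring]
  congr 2
  push_cast; ring

lemma th3_sq {t : ℂ} (ht : 0 < t.im) : th3 t ^ 2 = th3 (2 * t) ^ 2 + th2 (2 * t) ^ 2 := by
  have := jacobiTheta₂_mul 0 0 ht
  simp only [add_zero, sub_zero, zero_add, mul_zero] at this
  rw [th2_two_mul_sq, th3, th3, sq, this]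
  ring

lemma th4_sq {t : ℂ} (ht : 0 < t.im) : th4 t ^ 2 = th3 (2 * t) ^ 2 - th2 (2 * t) ^ 2 := by
  have := jacobiTheta₂_mul (1 / 2) (1 / 2) ht
  have h1 := jacobiTheta₂_add_left 0 (2 * t)
  have h2 := jacobiTheta₂_add_left t (2 * t)
  rw [add_halves, sub_self, zero_add, add_comm (1 : ℂ) t, h2,
    show 2 * (Real.pi : ℂ) * I * (1 / 2) + Real.pi * I * t = Real.pi * I + Real.pi * I * t by ring,
    Complex.exp_add, Complex.exp_pi_mul_I] at this
  rw [zero_add] at h1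
  rw [h1] at this
  rw [th2_two_mul_sq, th4, th3, sq, this]
  ring

lemma th3_mul_th4 {t : ℂ} (ht : 0 < t.im) : th3 t * th4 t = th4 (2 * t) ^ 2 := by
  have := jacobiTheta₂_mul 0 (1 / 2) ht
  rw [zero_add, jacobiTheta₂_half_add, zero_sub, jacobiTheta₂_neg_left] at this
  rw [th3, th4, th4, this]
  ring

/-- At `z = w = t / 2` the two cosets contribute equally, by quasi-periodicity. -/
lemma th2_sq {t : ℂ} (ht : 0 < t.im) : th2 t ^ 2 = 2 * th2 (2 * t) * th3 (2 * t) := by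
  have := jacobiTheta₂_mul (t / 2) (t / 2) ht
  have h1 := jacobiTheta₂_add_left' 0 (2 * t)
  rw [zero_add] at h1
  rw [add_halves, sub_self, zero_add, ← two_mul, h1] at this
  rw [th2, mul_pow, sq (jacobiTheta₂ _ _), this, th2, th3, show 2 * t / 2 = t by ring,
    ← Complex.exp_nat_mul]
  have e1 : cexp (2 * Real.pi * I * (t / 2) + Real.pi * I * t) *
      cexp (-Real.pi * I * (2 * t + 2 * 0)) = 1 := by
    rw [← Complex.exp_add, ← Complex.exp_zero]; congr 1; ring
  have e2 : cexp ((2 : ℕ) * (Real.pi * I * t / 4)) = cexp (Real.pi * I * (2 * t) / 4) := by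
    congr 1; push_cast; ring
  rw [e2]
  linear_combination cexp (Real.pi * I * (2 * t) / 4) * jacobiTheta₂ 0 (2 * t) *
    jacobiTheta₂ t (2 * t) * e1

lemma th4_two_mul_pow_four {t : ℂ} (ht : 0 < t.im) :
    th4 (2 * t) ^ 4 = th3 t ^ 2 * th4 t ^ 2 := by
  rw [show th4 (2 * t) ^ 4 = (th4 (2 * t) ^ 2) ^ 2 by ring, ← th3_mul_th4 ht]
  ring

/-- Jacobi's identity `θ₂⁴ + θ₄⁴ = θ₃⁴`. -/
lemma th2_pow_four {t : ℂ} (ht : 0 < t.im) : th2 t ^ 4 = th3 t ^ 4 - th4 t ^ 4 := by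
  have h2 := th2_sq ht
  have h3 := th3_sq ht
  have h4 := th4_sq ht
  linear_combination (th2 t ^ 2 + 2 * th2 (2 * t) * th3 (2 * t)) * h2 -
    (th3 t ^ 2 + th3 (2 * t) ^ 2 + th2 (2 * t) ^ 2) * h3 +
    (th4 t ^ 2 + th3 (2 * t) ^ 2 - th2 (2 * t) ^ 2) * h4

/-! ### Translation and inversion -/

lemma th3_add_one (t : ℂ) : th3 (t + 1) = th4 t := by
  simp only [th3, th4, jacobiTheta₂, jacobiTheta₂_term]
  refine tsum_congr fun n => Complex.exp_eq_exp_iff_exists_int.mpr ?_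
  -- `n ^ 2` and `n` have the same parity
  obtain ⟨k, hk⟩ := Int.even_mul_succ_self (n - 1)
  refine ⟨k, ?_⟩
  have : ((n : ℂ) - 1) * (n - 1 + 1) = k + k := by exact_mod_cast hk
  linear_combination (Real.pi * I) * this

lemma th4_add_one (t : ℂ) : th4 (t + 1) = th3 t := by
  rw [← th3_add_one, th3, th3, add_assoc, one_add_one_eq_two, jacobiTheta₂_add_right]

lemma th2_add_one (t : ℂ) : th2 (t + 1) = cexp (Real.pi * I / 4) * th2 t := by
  simp only [th2]
  rw [show Real.pi * I * (t + 1) / 4 = Real.pi * I / 4 + Real.pi * I * t / 4 by ring,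
    Complex.exp_add, mul_assoc]
  congr 2
  simp only [jacobiTheta₂, jacobiTheta₂_term]
  refine tsum_congr fun n => Complex.exp_eq_exp_iff_exists_int.mpr ?_
  obtain ⟨k, hk⟩ := Int.even_mul_succ_self n
  refine ⟨k, ?_⟩
  have : (n : ℂ) * (n + 1) = k + k := by exact_mod_cast hk
  linear_combination (Real.pi * I) * this

lemma th3_neg_inv {t : ℂ} (ht : 0 < t.im) :
    th3 (-1 / t) = (-I * t) ^ (1 / 2 : ℂ) * th3 t := by
  have h0 : t ≠ 0 := by rintro rfl; simp at ht
  have hc : (-I * t) ^ (1 / 2 : ℂ) ≠ 0 := by simp [cpow_eq_zero_iff, h0]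
  have := jacobiTheta₂_functional_equation 0 t
  simp only [zero_div, ne_eq, OfNat.ofNat_ne_zero, not_false_eq_true, zero_pow, mul_zero,
    Complex.exp_zero, mul_one] at this
  rw [th3, th3, this]
  field_simp

lemma th2_neg_inv {t : ℂ} (ht : 0 < t.im) :
    th2 (-1 / t) = (-I * t) ^ (1 / 2 : ℂ) * th4 t := by
  have h0 : t ≠ 0 := by rintro rfl; simp at ht
  have hc : (-I * t) ^ (1 / 2 : ℂ) ≠ 0 := by simp [cpow_eq_zero_iff, h0]
  have := jacobiTheta₂_functional_equation (1 / 2) t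
  rw [th2, th4, this, show -1 / t / 2 = -(1 / 2 / t) by field_simp, jacobiTheta₂_neg_left,
    show Real.pi * I * (-1 / t) / 4 = -Real.pi * I * (1 / 2) ^ 2 / t by field_simp; norm_num]
  field_simp

lemma th4_neg_inv {t : ℂ} (ht : 0 < t.im) :
    th4 (-1 / t) = (-I * t) ^ (1 / 2 : ℂ) * th2 t := by
  have h0 : t ≠ 0 := by rintro rfl; simp at ht
  have hc : (-I * t) ^ (1 / 2 : ℂ) ≠ 0 := by simp [cpow_eq_zero_iff, h0]
  have := jacobiTheta₂_functional_equation (t / 2) t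
  rw [th2, th4, this, show t / 2 / t = 1 / 2 by field_simp]
  have e : cexp (Real.pi * I * t / 4) * cexp (-Real.pi * I * (t / 2) ^ 2 / t) = 1 := by
    rw [← Complex.exp_add, ← Complex.exp_zero]; congr 1; field_simp; ring
  generalize jacobiTheta₂ (1 / 2) (-1 / t) = x
  generalize cexp (-Real.pi * I * (t / 2) ^ 2 / t) = y at *
  generalize cexp (Real.pi * I * t / 4) = w at *
  field_simp
  linear_combination -x * e

/-! ### Holomorphy and behaviour at the cusp -/

lemma differentiableAt_jacobiTheta₂_comp {f : ℂ → ℂ} {t : ℂ} (ht : 0 < t.im)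
    (hf : DifferentiableAt ℂ f t) : DifferentiableAt ℂ (fun s => jacobiTheta₂ (f s) s) t :=
  (hasFDerivAt_jacobiTheta₂ (f t) ht).differentiableAt.comp (f := fun s => (f s, s)) t
    (hf.prodMk differentiableAt_id)

lemma differentiableAt_th3 {t : ℂ} (ht : 0 < t.im) : DifferentiableAt ℂ th3 t :=
  differentiableAt_jacobiTheta₂_snd _ ht

lemma differentiableAt_th4 {t : ℂ} (ht : 0 < t.im) : DifferentiableAt ℂ th4 t :=
  differentiableAt_jacobiTheta₂_snd _ ht

lemma differentiableAt_th2 {t : ℂ} (ht : 0 < t.im) : DifferentiableAt ℂ th2 t :=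
  .mul (by fun_prop) (differentiableAt_jacobiTheta₂_comp ht (by fun_prop))

/-- The filter of neighbourhoods of the cusp `i ∞` in the complex plane. -/
abbrev imTop : Filter ℂ := comap Complex.im atTop

/-- The absolute value of the nome `exp (π i t)`. -/
def nome (t : ℂ) : ℝ := Real.exp (-Real.pi * t.im)

lemma nome_pos (t : ℂ) : 0 < nome t := Real.exp_pos _

lemma tendsto_nome : Tendsto nome imTop (𝓝 0) :=
  Real.tendsto_exp_atBot.comp
    (tendsto_comap.const_mul_atTop_of_neg (neg_lt_zero.mpr Real.pi_pos))

lemma th3_isBigO : (fun t => th3 t - 1) =O[imTop] nome := by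
  have := isBigO_at_im_infty_jacobiTheta_sub_one
  simpa only [jacobiTheta_eq_jacobiTheta₂] using! this

lemma th4_isBigO : (fun t => th4 t - 1) =O[imTop] nome := by
  have h : Tendsto (fun t : ℂ => t + 1) imTop imTop :=
    tendsto_comap_iff.mpr (by simpa [Function.comp_def] using! tendsto_comap)
  have := th3_isBigO.comp_tendsto h
  change _ =O[imTop] fun t => nome t
  simpa [Function.comp_def, th3_add_one, nome] using this

/-- The terms of index `n` and `-1 - n` of `θ₂` agree, so `θ₂` is `exp (π i t / 4)` times
`2 ∑ exp (π i n (n + 1) t)`, summed over the natural numbers. -/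
lemma jacobiTheta₂_half_self_sub_two_norm_le {t : ℂ} (ht : 0 < t.im) :
    ‖jacobiTheta₂ (t / 2) t - 2‖ ≤ 2 * nome t / (1 - nome t) := by
  have hr1 : nome t < 1 := by
    rw [nome, Real.exp_lt_one_iff]; nlinarith [Real.pi_pos]
  have hr0 : 0 ≤ nome t := (nome_pos t).le
  have hs := (hasSum_jacobiTheta₂_term (t / 2) ht).nat_add_neg_add_one
  have hterm (n : ℕ) : jacobiTheta₂_term n (t / 2) t + jacobiTheta₂_term (-(n + 1)) (t / 2) t =
      2 * cexp (Real.pi * I * (n * (n + 1)) * t) := by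
    simp only [jacobiTheta₂_term]
    rw [two_mul (cexp _)]
    congr 1
    · congr 1; push_cast; ring
    · congr 1; push_cast; ring
  simp_rw [hterm] at hs
  have hs' := (hasSum_nat_add_iff' 1).mpr hs
  simp only [Finset.range_one, Finset.sum_singleton, Nat.cast_zero, zero_mul, mul_zero,
    Complex.exp_zero, mul_one] at hs'
  rw [← hs'.tsum_eq]
  have hb (n : ℕ) : ‖2 * cexp (Real.pi * I * (((n + 1 : ℕ) : ℂ) * (((n + 1 : ℕ) : ℂ) + 1)) * t)‖ ≤
      2 * nome t * nome t ^ n := by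
    rw [norm_mul, Complex.norm_ofNat, mul_assoc (2 : ℝ), ← pow_succ', nome, ← Real.exp_nat_mul,
      Complex.norm_exp]
    gcongr
    have : (Real.pi * I * (((n + 1 : ℕ) : ℂ) * (((n + 1 : ℕ) : ℂ) + 1)) * t).re =
        -Real.pi * t.im * ((n + 1 : ℕ) * ((n + 1 : ℕ) + 1)) := by
      rw [show (Real.pi * I * (((n + 1 : ℕ) : ℂ) * (((n + 1 : ℕ) : ℂ) + 1)) * t) =
        ((Real.pi * ((n + 1 : ℕ) * ((n + 1 : ℕ) + 1)) : ℝ) : ℂ) * (I * t) by push_cast; ring,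
        Complex.re_ofReal_mul, Complex.I_mul_re]
      ring
    rw [this]
    have h1 : 0 ≤ Real.pi * t.im := by positivity
    have h2 : (0 : ℝ) ≤ (n + 1 : ℕ) := by positivity
    nlinarith [mul_nonneg h1 (mul_nonneg h2 h2)]
  refine (tsum_of_norm_bounded ((hasSum_geometric_of_lt_one hr0 hr1).mul_left _) hb).trans_eq ?_
  ring

lemma jacobiTheta₂_half_self_isBigO :
    (fun t => jacobiTheta₂ (t / 2) t - 2) =O[imTop] nome := by
  refine Asymptotics.IsBigO.of_bound 4 ?_
  have h1 : ∀ᶠ t in imTop, nome t < 1 / 2 := tendsto_nome.eventually_lt_const (by norm_num)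
  have h2 : ∀ᶠ t in imTop, 0 < t.im := tendsto_comap.eventually_gt_atTop 0
  filter_upwards [h1, h2] with t h1 h2
  have h0 := nome_pos t
  refine (jacobiTheta₂_half_self_sub_two_norm_le h2).trans ?_
  rw [Real.norm_of_nonneg h0.le, div_le_iff₀ (by linarith)]
  nlinarith

lemma tendsto_of_sub_isBigO_nome {f : ℂ → ℂ} {c : ℂ} (h : (fun t => f t - c) =O[imTop] nome) :
    Tendsto f imTop (𝓝 c) := by
  simpa using (h.trans_tendsto tendsto_nome).add_const c

lemma tendsto_two_pow_mul {t : ℂ} (ht : 0 < t.im) :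
    Tendsto (fun n : ℕ => (2 : ℂ) ^ n * t) atTop imTop := by
  refine tendsto_comap_iff.mpr ?_
  have : (im ∘ fun n : ℕ => (2 : ℂ) ^ n * t) = fun n : ℕ => (2 : ℝ) ^ n * t.im := by
    ext n
    have : ((2 : ℂ) ^ n * t) = (((2 : ℝ) ^ n : ℝ) : ℂ) * t := by push_cast; rfl
    rw [Function.comp, this, Complex.im_ofReal_mul]
  rw [this]
  exact (tendsto_pow_atTop_atTop_of_one_lt one_lt_two).atTop_mul_const ht

lemma im_two_pow_mul_pos {t : ℂ} (ht : 0 < t.im) (n : ℕ) : 0 < ((2 : ℂ) ^ n * t).im := by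
  have : ((2 : ℂ) ^ n * t) = (((2 : ℝ) ^ n : ℝ) : ℂ) * t := by push_cast; rfl
  rw [this, Complex.im_ofReal_mul]
  positivity

/-- A function whose zeros are stable under `t ↦ 2 t` and which has a nonzero limit at the cusp has
no zeros. -/
lemma ne_zero_of_two_mul {f : ℂ → ℂ} {c : ℂ} (hc : c ≠ 0) (hf : Tendsto f imTop (𝓝 c))
    (h : ∀ t : ℂ, 0 < t.im → f t = 0 → f (2 * t) = 0) {t : ℂ} (ht : 0 < t.im) : f t ≠ 0 := by
  intro h0
  have hn (n : ℕ) : f (2 ^ n * t) = 0 := by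
    induction n with
    | zero => simpa using h0
    | succ n ih =>
      rw [pow_succ', mul_assoc]
      exact h _ (im_two_pow_mul_pos ht n) ih
  have := hf.comp (tendsto_two_pow_mul ht)
  refine hc (tendsto_nhds_unique this ?_)
  simp only [Function.comp_def, hn, tendsto_const_nhds]

lemma th4_ne_zero {t : ℂ} (ht : 0 < t.im) : th4 t ≠ 0 :=
  ne_zero_of_two_mul one_ne_zero (tendsto_of_sub_isBigO_nome th4_isBigO)
    (fun t ht h => by simpa [h] using (th3_mul_th4 ht).symm) ht

lemma th3_ne_zero {t : ℂ} (ht : 0 < t.im) : th3 t ≠ 0 := fun h =>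
  pow_ne_zero 2 (th4_ne_zero (im_two_mul_pos ht)) (by rw [← th3_mul_th4 ht, h, zero_mul])

lemma jacobiTheta₂_half_self_ne_zero {t : ℂ} (ht : 0 < t.im) : jacobiTheta₂ (t / 2) t ≠ 0 := by
  refine ne_zero_of_two_mul two_ne_zero
    (tendsto_of_sub_isBigO_nome jacobiTheta₂_half_self_isBigO) (fun t ht h => ?_) ht
  have := th2_sq ht
  rw [th2, h, mul_zero, zero_pow two_ne_zero, eq_comm, mul_eq_zero,
    or_iff_left (th3_ne_zero (im_two_mul_pos ht))] at this
  simpa [th2] using this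

lemma th2_ne_zero {t : ℂ} (ht : 0 < t.im) : th2 t ≠ 0 :=
  mul_ne_zero (Complex.exp_ne_zero _) (jacobiTheta₂_half_self_ne_zero ht)

/-! ### Logarithmic derivatives of the theta constants -/

/-- Four times the logarithmic derivative with respect to the derivation `(π i)⁻¹ d/dt`, which is
`q d/dq` for the nome `q = exp (π i t)`. -/
def thetaLog (f : ℂ → ℂ) (t : ℂ) : ℂ := 4 / (Real.pi * I) * (deriv f t / f t)

lemma pi_mul_I_ne_zero : (Real.pi : ℂ) * I ≠ 0 :=
  mul_ne_zero (ofReal_ne_zero.mpr Real.pi_ne_zero) I_ne_zero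

lemma hasDerivAt_thetaLog {f : ℂ → ℂ} {t : ℂ} (hf : DifferentiableAt ℂ f t) (h0 : f t ≠ 0) :
    HasDerivAt f (Real.pi * I / 4 * (thetaLog f t * f t)) t := by
  have := pi_mul_I_ne_zero
  refine hf.hasDerivAt.congr_deriv ?_
  rw [thetaLog]
  field_simp

lemma hasDerivAt_thetaLog_two_mul {f : ℂ → ℂ} {t : ℂ} (hf : DifferentiableAt ℂ f (2 * t))
    (h0 : f (2 * t) ≠ 0) :
    HasDerivAt (fun s => f (2 * s)) (Real.pi * I / 4 * (2 * thetaLog f (2 * t) * f (2 * t))) t := by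
  have h := (hasDerivAt_thetaLog hf h0).comp t ((hasDerivAt_id t).const_mul 2)
  exact h.congr_deriv (by ring)

lemma eventually_im_pos {t : ℂ} (ht : 0 < t.im) : ∀ᶠ s in 𝓝 t, 0 < s.im :=
  continuous_im.continuousAt.eventually_const_lt ht

/-- Functions equal on the upper half-plane have equal derivatives there. -/
lemma hasDerivAt_unique_of_eq {f g : ℂ → ℂ} {a b t : ℂ} (ht : 0 < t.im)
    (h : ∀ s : ℂ, 0 < s.im → f s = g s) (hf : HasDerivAt f a t) (hg : HasDerivAt g b t) : a = b :=
  hf.unique (hg.congr_of_eventuallyEq ((eventually_im_pos ht).mono h))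

lemma hasDerivAt_th2 {t : ℂ} (ht : 0 < t.im) :
    HasDerivAt th2 (Real.pi * I / 4 * (thetaLog th2 t * th2 t)) t :=
  hasDerivAt_thetaLog (differentiableAt_th2 ht) (th2_ne_zero ht)

lemma hasDerivAt_th3 {t : ℂ} (ht : 0 < t.im) :
    HasDerivAt th3 (Real.pi * I / 4 * (thetaLog th3 t * th3 t)) t :=
  hasDerivAt_thetaLog (differentiableAt_th3 ht) (th3_ne_zero ht)

lemma hasDerivAt_th4 {t : ℂ} (ht : 0 < t.im) :
    HasDerivAt th4 (Real.pi * I / 4 * (thetaLog th4 t * th4 t)) t :=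
  hasDerivAt_thetaLog (differentiableAt_th4 ht) (th4_ne_zero ht)

lemma hasDerivAt_th2_two_mul {t : ℂ} (ht : 0 < t.im) : HasDerivAt (fun s => th2 (2 * s))
    (Real.pi * I / 4 * (2 * thetaLog th2 (2 * t) * th2 (2 * t))) t :=
  hasDerivAt_thetaLog_two_mul (differentiableAt_th2 (im_two_mul_pos ht))
    (th2_ne_zero (im_two_mul_pos ht))

lemma hasDerivAt_th3_two_mul {t : ℂ} (ht : 0 < t.im) : HasDerivAt (fun s => th3 (2 * s))
    (Real.pi * I / 4 * (2 * thetaLog th3 (2 * t) * th3 (2 * t))) t :=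
  hasDerivAt_thetaLog_two_mul (differentiableAt_th3 (im_two_mul_pos ht))
    (th3_ne_zero (im_two_mul_pos ht))

lemma thetaLog_th2_eq_add {t : ℂ} (ht : 0 < t.im) :
    thetaLog th2 t = thetaLog th2 (2 * t) + thetaLog th3 (2 * t) := by
  have h := hasDerivAt_unique_of_eq ht (fun s hs => th2_sq hs) ((hasDerivAt_th2 ht).fun_pow 2)
    (((hasDerivAt_th2_two_mul ht).const_mul 2).mul (hasDerivAt_th3_two_mul ht))
  have h0 := th2_ne_zero ht
  have hp := pi_mul_I_ne_zero
  refine mul_left_cancel₀ (mul_ne_zero hp (pow_ne_zero 2 h0)) ?_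
  push_cast at h
  linear_combination 2 * h - Real.pi * I * (thetaLog th2 (2 * t) + thetaLog th3 (2 * t)) * th2_sq ht

lemma th3_sq_mul_thetaLog {t : ℂ} (ht : 0 < t.im) : th3 t ^ 2 * thetaLog th3 t =
    2 * (th3 (2 * t) ^ 2 * thetaLog th3 (2 * t) + th2 (2 * t) ^ 2 * thetaLog th2 (2 * t)) := by
  have h := hasDerivAt_unique_of_eq ht (fun s hs => th3_sq hs) ((hasDerivAt_th3 ht).fun_pow 2)
    (((hasDerivAt_th3_two_mul ht).fun_pow 2).add ((hasDerivAt_th2_two_mul ht).fun_pow 2))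
  refine mul_left_cancel₀ pi_mul_I_ne_zero ?_
  push_cast at h
  linear_combination 2 * h

lemma th4_sq_mul_thetaLog {t : ℂ} (ht : 0 < t.im) : th4 t ^ 2 * thetaLog th4 t =
    2 * (th3 (2 * t) ^ 2 * thetaLog th3 (2 * t) - th2 (2 * t) ^ 2 * thetaLog th2 (2 * t)) := by
  have h := hasDerivAt_unique_of_eq ht (fun s hs => th4_sq hs) ((hasDerivAt_th4 ht).fun_pow 2)
    (((hasDerivAt_th3_two_mul ht).fun_pow 2).sub ((hasDerivAt_th2_two_mul ht).fun_pow 2))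
  refine mul_left_cancel₀ pi_mul_I_ne_zero ?_
  push_cast at h
  linear_combination 2 * h

lemma th2_pow_four_mul_thetaLog {t : ℂ} (ht : 0 < t.im) :
    th2 t ^ 4 * thetaLog th2 t = th3 t ^ 4 * thetaLog th3 t - th4 t ^ 4 * thetaLog th4 t := by
  have h := hasDerivAt_unique_of_eq ht (fun s hs => th2_pow_four hs)
    ((hasDerivAt_th2 ht).fun_pow 4)
    (((hasDerivAt_th3 ht).fun_pow 4).sub ((hasDerivAt_th4 ht).fun_pow 4))
  refine mul_left_cancel₀ pi_mul_I_ne_zero ?_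
  push_cast at h
  linear_combination h

/-- The derivative of Jacobi's identity `θ₂⁴ + θ₄⁴ = θ₃⁴`, in a form that expresses one difference
of logarithmic derivatives by another. -/
lemma th2_pow_four_mul_sub {t : ℂ} (ht : 0 < t.im) :
    th2 t ^ 4 * (thetaLog th2 t - thetaLog th3 t) =
      th4 t ^ 4 * (thetaLog th3 t - thetaLog th4 t) := by
  linear_combination th2_pow_four_mul_thetaLog ht - thetaLog th3 t * th2_pow_four ht

/-- The quotient of `4 (θ₂' / θ₂ - θ₃' / θ₃)` by `θ₄⁴` is invariant under `t ↦ 2 t`. -/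
lemma sub_div_th4_two_mul {t : ℂ} (ht : 0 < t.im) :
    (thetaLog th2 (2 * t) - thetaLog th3 (2 * t)) / th4 (2 * t) ^ 4 =
      (thetaLog th2 t - thetaLog th3 t) / th4 t ^ 4 := by
  have h2 := th2_ne_zero ht
  have h3 := th3_ne_zero ht
  have h4 := th4_ne_zero ht
  rw [th4_two_mul_pow_four ht, div_eq_div_iff (by positivity) (by positivity)]
  have e1 : th2 t ^ 4 * (thetaLog th2 (2 * t) - thetaLog th3 (2 * t)) =
      th3 t ^ 2 * th4 t ^ 2 * (thetaLog th3 t - thetaLog th4 t) := by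
    have hs : th2 t ^ 4 = 4 * th2 (2 * t) ^ 2 * th3 (2 * t) ^ 2 := by
      rw [show th2 t ^ 4 = (th2 t ^ 2) ^ 2 by ring, th2_sq ht]; ring
    rw [hs]
    linear_combination (-(th4 t ^ 2)) * th3_sq_mul_thetaLog ht +
      th3 t ^ 2 * th4_sq_mul_thetaLog ht +
      (2 * th3 (2 * t) ^ 2 * thetaLog th3 (2 * t) -
        2 * th2 (2 * t) ^ 2 * thetaLog th2 (2 * t)) * th3_sq ht -
      (2 * th3 (2 * t) ^ 2 * thetaLog th3 (2 * t) +
        2 * th2 (2 * t) ^ 2 * thetaLog th2 (2 * t)) * th4_sq ht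
  refine mul_left_cancel₀ (pow_ne_zero 4 h2) ?_
  linear_combination th4 t ^ 4 * e1 - th3 t ^ 2 * th4 t ^ 2 * th2_pow_four_mul_sub ht

/-! ### Decay of derivatives at the cusp -/

/-- By Cauchy's estimate on discs of radius one, exponential decay at the cusp passes to the
derivative. -/
lemma deriv_isBigO_nome {f : ℂ → ℂ} {c : ℂ} (hf : ∀ t : ℂ, 0 < t.im → DifferentiableAt ℂ f t)
    (h : (fun t => f t - c) =O[imTop] nome) : deriv f =O[imTop] nome := by
  obtain ⟨C, hC0, hC⟩ := h.exists_pos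
  rw [Asymptotics.IsBigOWith, eventually_comap] at hC
  obtain ⟨N, hN⟩ := eventually_atTop.mp hC
  refine Asymptotics.IsBigO.of_bound (C * Real.exp Real.pi) ?_
  have h1 : ∀ᶠ t in imTop, max N 0 + 1 < t.im := tendsto_comap.eventually_gt_atTop _
  filter_upwards [h1] with t ht
  have him {z : ℂ} (hz : z ∈ Metric.closedBall t 1) : t.im - 1 ≤ z.im := by
    have := (Complex.abs_im_le_norm (z - t)).trans (by simpa [dist_eq_norm] using hz)
    rw [Complex.sub_im, abs_le] at this
    linarith
  have hpos {z : ℂ} (hz : z ∈ Metric.closedBall t 1) : 0 < z.im := by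
    linarith [him hz, le_max_right N 0]
  have hd : DiffContOnCl ℂ (fun z => f z - c) (Metric.ball t 1) := by
    refine DifferentiableOn.diffContOnCl fun z hz => ?_
    rw [closure_ball t one_ne_zero] at hz
    exact ((hf z (hpos hz)).sub_const c).differentiableWithinAt
  have := Complex.norm_deriv_le_of_forall_mem_sphere_norm_le
    (C := C * Real.exp Real.pi * nome t) one_pos hd fun z hz => by
      have hz' := Metric.sphere_subset_closedBall hz
      refine (hN z.im (by linarith [him hz', le_max_left N 0]) z rfl).trans ?_
      rw [mul_assoc, Real.norm_of_nonneg (nome_pos _).le, nome, nome, ← Real.exp_add]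
      gcongr
      nlinarith [him hz', Real.pi_pos]
  rw [deriv_sub_const, div_one] at this
  rwa [Real.norm_of_nonneg (nome_pos _).le]

lemma thetaLog_isBigO {f : ℂ → ℂ} {c : ℂ} (hc : c ≠ 0)
    (hf : ∀ t : ℂ, 0 < t.im → DifferentiableAt ℂ f t)
    (h : (fun t => f t - c) =O[imTop] nome) : thetaLog f =O[imTop] nome := by
  have h1 : (fun t => (f t)⁻¹) =O[imTop] fun _ => (1 : ℝ) :=
    ((tendsto_of_sub_isBigO_nome h).inv₀ hc).isBigO_one ℝ
  have h2 := ((deriv_isBigO_nome hf h).mul h1).const_mul_left (4 / (Real.pi * I))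
  simp only [mul_one] at h2
  exact h2

lemma thetaLog_th2_eq_one_add {t : ℂ} (ht : 0 < t.im) :
    thetaLog th2 t = 1 + thetaLog (fun s => jacobiTheta₂ (s / 2) s) t := by
  have hg : DifferentiableAt ℂ (fun s => jacobiTheta₂ (s / 2) s) t :=
    differentiableAt_jacobiTheta₂_comp ht (by fun_prop)
  have he : HasDerivAt (fun s => cexp (Real.pi * I * s / 4))
      (cexp (Real.pi * I * t / 4) * (Real.pi * I / 4)) t := by
    refine HasDerivAt.cexp ?_
    simpa using ((hasDerivAt_id t).const_mul (Real.pi * I)).div_const 4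
  have hd : deriv th2 t = _ := (he.mul hg.hasDerivAt).deriv
  have h0 := jacobiTheta₂_half_self_ne_zero ht
  have hp := pi_mul_I_ne_zero
  have he0 := Complex.exp_ne_zero (Real.pi * I * t / 4)
  rw [thetaLog, thetaLog, hd, th2]
  field_simp

lemma thetaLog_th2_isBigO : (fun t => thetaLog th2 t - 1) =O[imTop] nome := by
  have h1 : ∀ᶠ t in imTop, 0 < t.im := tendsto_comap.eventually_gt_atTop 0
  refine (thetaLog_isBigO two_ne_zero
    (fun t ht => differentiableAt_jacobiTheta₂_comp ht (by fun_prop))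
    jacobiTheta₂_half_self_isBigO).congr' (h1.mono fun t ht => ?_) .rfl
  simp only [thetaLog_th2_eq_one_add ht, add_sub_cancel_left]

lemma eq_of_two_mul_invariant {f : ℂ → ℂ} {c : ℂ} (hf : Tendsto f imTop (𝓝 c))
    (h : ∀ t : ℂ, 0 < t.im → f (2 * t) = f t) {t : ℂ} (ht : 0 < t.im) : f t = c := by
  have hn (n : ℕ) : f (2 ^ n * t) = f t := by
    induction n with
    | zero => simp
    | succ n ih => rw [pow_succ', mul_assoc, h _ (im_two_pow_mul_pos ht n), ih]
  have := hf.comp (tendsto_two_pow_mul ht)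
  simp only [Function.comp_def, hn] at this
  exact tendsto_nhds_unique tendsto_const_nhds this

/-- `4 (θ₂' / θ₂ - θ₃' / θ₃) = θ₄⁴`: the quotient of the two sides is invariant under `t ↦ 2 t` and
tends to `1` at the cusp. -/
lemma thetaLog_th2_sub_th3 {t : ℂ} (ht : 0 < t.im) :
    thetaLog th2 t - thetaLog th3 t = th4 t ^ 4 := by
  have h2 := tendsto_of_sub_isBigO_nome thetaLog_th2_isBigO
  have h3 : Tendsto (thetaLog th3) imTop (𝓝 0) := (thetaLog_isBigO one_ne_zero
    (fun t ht => differentiableAt_th3 ht) th3_isBigO).trans_tendsto tendsto_nome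
  have h4 := (tendsto_of_sub_isBigO_nome th4_isBigO).pow 4
  have := eq_of_two_mul_invariant ((h2.sub h3).div h4 (by simp)) 
    (fun t ht => sub_div_th4_two_mul ht) ht
  rw [Pi.div_apply, sub_zero, one_pow, div_one, 
    div_eq_one_iff_eq (pow_ne_zero 4 (th4_ne_zero ht))] at this
  exact this

lemma thetaLog_th3_sub_th4 {t : ℂ} (ht : 0 < t.im) :
    thetaLog th3 t - thetaLog th4 t = th2 t ^ 4 := by
  refine mul_left_cancel₀ (pow_ne_zero 4 (th4_ne_zero ht)) ?_
  rw [← th2_pow_four_mul_sub ht, thetaLog_th2_sub_th3 ht, mul_comm]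

lemma thetaLog_th3 {t : ℂ} (ht : 0 < t.im) : thetaLog th3 t = thetaLog th2 t - th4 t ^ 4 := by
  linear_combination -thetaLog_th2_sub_th3 ht

lemma thetaLog_th4 {t : ℂ} (ht : 0 < t.im) : thetaLog th4 t = thetaLog th2 t - th3 t ^ 4 := by
  linear_combination -thetaLog_th2_sub_th3 ht - thetaLog_th3_sub_th4 ht - th2_pow_four ht

/-! ### The Riccati equation -/

lemma thetaLog_th2_two_mul {t : ℂ} (ht : 0 < t.im) :
    thetaLog th2 t = 2 * thetaLog th2 (2 * t) - th3 t ^ 2 * th4 t ^ 2 := by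
  linear_combination thetaLog_th2_eq_add ht + thetaLog_th3 (im_two_mul_pos ht) -
    th4_two_mul_pow_four ht

lemma differentiableAt_thetaLog_th2 {t : ℂ} (ht : 0 < t.im) :
    DifferentiableAt ℂ (thetaLog th2) t := by
  have ho : IsOpen {s : ℂ | 0 < s.im} := isOpen_lt continuous_const continuous_im
  have hd : DifferentiableOn ℂ th2 {s : ℂ | 0 < s.im} := fun s hs =>
    (differentiableAt_th2 hs).differentiableWithinAt
  exact (((hd.deriv ho).differentiableAt (ho.mem_nhds ht)).div (differentiableAt_th2 ht)
    (th2_ne_zero ht)).const_mul _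

/-- The defect of the Riccati equation `2 P' = P² - θ₃⁴ θ₄⁴` for `P = 4 θ₂' / θ₂`. -/
def riccatiDefect (t : ℂ) : ℂ :=
  2 / (Real.pi * I) * deriv (thetaLog th2) t - thetaLog th2 t ^ 2 + th3 t ^ 4 * th4 t ^ 4

lemma riccatiDefect_two_mul {t : ℂ} (ht : 0 < t.im) :
    riccatiDefect t = 4 * riccatiDefect (2 * t) := by
  have h2 := im_two_mul_pos ht
  have hP := (differentiableAt_thetaLog_th2 ht).hasDerivAt
  have hP2 : HasDerivAt (fun s => thetaLog th2 (2 * s))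
      (deriv (thetaLog th2) (2 * t) * (2 * 1)) t :=
    (differentiableAt_thetaLog_th2 h2).hasDerivAt.comp t ((hasDerivAt_id t).const_mul 2)
  have h := hasDerivAt_unique_of_eq ht (fun s hs => thetaLog_th2_two_mul hs) hP
    ((hP2.const_mul 2).sub
      (((hasDerivAt_th3 ht).fun_pow 2).mul ((hasDerivAt_th4 ht).fun_pow 2)))
  have hp := pi_mul_I_ne_zero
  have hX3 : 4 * th3 (2 * t) ^ 4 = (th3 t ^ 2 + th4 t ^ 2) ^ 2 := by
    rw [th3_sq ht, th4_sq ht]; ring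
  rw [riccatiDefect, riccatiDefect, h, th4_two_mul_pow_four ht, thetaLog_th3 ht, thetaLog_th4 ht,
    thetaLog_th2_two_mul ht]
  push_cast
  field_simp
  linear_combination (-4 * Real.pi * I * th3 t ^ 2 * th4 t ^ 2) * hX3

lemma riccatiDefect_isBigO : riccatiDefect =O[imTop] nome := by
  have hP := thetaLog_th2_isBigO
  have hd := (deriv_isBigO_nome (fun t ht => differentiableAt_thetaLog_th2 ht) hP).const_mul_left
    (2 / (Real.pi * I))
  have hmul {f g : ℂ → ℂ} (hf : (fun t => f t - 1) =O[imTop] nome)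
      (hg : (fun t => g t - 1) =O[imTop] nome) : (fun t => f t * g t - 1) =O[imTop] nome := by
    have h1 : g =O[imTop] fun _ => (1 : ℝ) := (tendsto_of_sub_isBigO_nome hg).isBigO_one ℝ
    have h2 : (fun t => (f t - 1) * g t) =O[imTop] nome := by simpa using! hf.mul h1
    exact (h2.add hg).congr_left fun t => by ring
  have h34 := hmul th3_isBigO th4_isBigO
  refine ((hd.sub (hmul hP hP)).add (hmul (hmul h34 h34) (hmul h34 h34))).congr_left fun t => ?_
  rw [riccatiDefect]
  ring

/-- The Riccati equation holds: its defect is multiplied by `1/4` under `t ↦ 2 t`, which for a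
nonzero value is incompatible with exponential decay at the cusp. -/
lemma riccatiDefect_eq_zero {t : ℂ} (ht : 0 < t.im) : riccatiDefect t = 0 := by
  have hn (n : ℕ) : riccatiDefect t = 4 ^ n * riccatiDefect (2 ^ n * t) := by
    induction n with
    | zero => simp
    | succ n ih =>
      rw [ih, riccatiDefect_two_mul (im_two_pow_mul_pos ht n), pow_succ, pow_succ', mul_assoc,
        mul_assoc 2]
  have hO := riccatiDefect_isBigO.comp_tendsto (tendsto_two_pow_mul ht)
  have hlim : Tendsto (fun n : ℕ => (4 : ℝ) ^ n * nome (2 ^ n * t)) atTop (𝓝 0) := by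
    have hc : 0 < Real.pi * t.im := mul_pos Real.pi_pos ht
    have h1 := (Real.tendsto_pow_mul_exp_neg_atTop_nhds_zero 2).comp
      ((tendsto_pow_atTop_atTop_of_one_lt one_lt_two).atTop_mul_const hc)
    have h2 := h1.const_mul ((Real.pi * t.im) ^ 2)⁻¹
    rw [mul_zero] at h2
    refine h2.congr fun n => ?_
    have him : ((2 : ℂ) ^ n * t).im = 2 ^ n * t.im := by
      have : ((2 : ℂ) ^ n * t) = (((2 : ℝ) ^ n : ℝ) : ℂ) * t := by push_cast; rfl
      rw [this, Complex.im_ofReal_mul]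
    simp only [Function.comp_apply, nome, him]
    rw [show (4 : ℝ) ^ n = (2 ^ n) ^ 2 by rw [← pow_mul, mul_comm, pow_mul]; norm_num,
      show -((2 : ℝ) ^ n * (Real.pi * t.im)) = -Real.pi * (2 ^ n * t.im) by ring]
    field_simp
  have h4 : (fun n : ℕ => (4 : ℂ) ^ n) =O[atTop] fun n : ℕ => (4 : ℝ) ^ n :=
    Asymptotics.isBigO_of_le _ fun n => by simp
  have := (h4.mul hO).trans_tendsto hlim
  simp only [Function.comp_def, ← hn] at this
  exact tendsto_nhds_unique tendsto_const_nhds this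

/-! ### The discriminant and the Eisenstein series of weight two -/

/-- The product `(θ₂ θ₃ θ₄) ^ 8`, a cusp form of level one and weight twelve. -/
def thetaProd (z : UpperHalfPlane) : ℂ := (th2 z * th3 z * th4 z) ^ 8

section Discriminant

open ModularForm ModularGroup
open scoped MatrixGroups

lemma thetaProd_S : (thetaProd ∣[(12 : ℤ)] S) = thetaProd := by
  ext z
  have hz : 0 < (z : ℂ).im := z.im_pos
  have h0 : (z : ℂ) ≠ 0 := z.ne_zero
  have hc : ((-I * (z : ℂ)) ^ (1 / 2 : ℂ)) ^ 2 = -I * z := by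
    rw [← cpow_nat_mul]; norm_num
  have hc' : ((-I * (z : ℂ)) ^ (1 / 2 : ℂ)) ^ 24 = (z : ℂ) ^ 12 := by
    rw [show 24 = 2 * 12 from rfl, pow_mul, hc, mul_pow, neg_pow, show 12 = 4 * 3 from rfl,
      pow_mul I, I_pow_four]
    norm_num
  rw [SlashInvariantForm.slash_S_apply]
  have hS : (-(z : ℂ))⁻¹ = -1 / (z : ℂ) := by simp [neg_div, inv_neg]
  simp only [thetaProd]
  rw [hS, th2_neg_inv hz, th3_neg_inv hz, th4_neg_inv hz, zpow_neg,
    show (z : ℂ) ^ (12 : ℤ) = (z : ℂ) ^ 12 by norm_cast, ← div_eq_mul_inv,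
    div_eq_iff (pow_ne_zero _ h0), ← hc']
  ring

lemma thetaProd_T : (thetaProd ∣[(12 : ℤ)] T) = thetaProd := by
  ext z
  have h1 : (((1 : ℝ) +ᵥ z : UpperHalfPlane) : ℂ) = (z : ℂ) + 1 := by simp [add_comm]
  have h8 : cexp (Real.pi * I / 4) ^ 8 = 1 := by
    rw [← Complex.exp_nat_mul, ← Complex.exp_two_pi_mul_I]; congr 1; push_cast; ring
  rw [SL_slash_apply, UpperHalfPlane.modular_T_smul, ModularGroup.denom_apply]
  have hT0 : T 1 0 = 0 := rfl
  have hT1 : T 1 1 = 1 := rfl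
  simp only [thetaProd, hT0, hT1, Int.cast_zero, Int.cast_one, zero_mul, zero_add, one_zpow, h1,
    th2_add_one, th3_add_one, th4_add_one]
  linear_combination (th2 z * th3 z * th4 z) ^ 8 * h8

lemma tendsto_coe_atImInfty :
    Tendsto ((↑) : UpperHalfPlane → ℂ) UpperHalfPlane.atImInfty imTop :=
  tendsto_comap_iff.mpr tendsto_comap

lemma thetaProd_isZeroAtImInfty : UpperHalfPlane.IsZeroAtImInfty thetaProd := by
  have h3 := (tendsto_of_sub_isBigO_nome th3_isBigO).pow 4
  have h4 := (tendsto_of_sub_isBigO_nome th4_isBigO).pow 4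
  have h := ((((h3.sub h4).mul h3).mul h4).pow 2).comp tendsto_coe_atImInfty
  norm_num at h
  refine h.congr fun z => ?_
  simp only [Function.comp_apply, thetaProd, ← th2_pow_four z.im_pos]
  ring

/-- The cusp form `(θ₂ θ₃ θ₄) ^ 8`. -/
def thetaCuspForm : CuspForm 𝒮ℒ 12 where
  toFun := thetaProd
  slash_action_eq' A hA := by
    obtain ⟨A, rfl⟩ := hA
    exact SlashInvariantForm.slash_action_generators_SL2Z thetaProd_S thetaProd_T A
  holo' := by
    rw [UpperHalfPlane.mdifferentiable_iff]
    refine DifferentiableOn.congr (f := fun t => (th2 t * th3 t * th4 t) ^ 8) (fun t ht =>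
      ((((differentiableAt_th2 ht).mul (differentiableAt_th3 ht)).mul
        (differentiableAt_th4 ht)).pow 8).differentiableWithinAt) fun t ht => ?_
    simp [thetaProd, UpperHalfPlane.ofComplex_apply_of_im_pos ht]
  zero_at_cusps' hc := by
    rw [Subgroup.IsArithmetic.isCusp_iff_isCusp_SL2Z] at hc
    rw [OnePoint.isZeroAt_iff_forall_SL2Z hc]
    intro γ _
    rw [SlashInvariantForm.slash_action_generators_SL2Z thetaProd_S thetaProd_T]
    exact thetaProd_isZeroAtImInfty

lemma exists_th_mul_pow_eq_eta :
    ∃ c : ℂ, ∀ s : ℂ, 0 < s.im → (th2 s * th3 s * th4 s) ^ 8 = c * ModularForm.eta s ^ 24 := by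
  obtain ⟨c, hc⟩ := CuspForm.exists_smul_discriminant_of_weight_eq_twelve thetaCuspForm
  refine ⟨c, fun s hs => ?_⟩
  have h : (c • CuspForm.discriminant) ⟨s, hs⟩ = thetaCuspForm ⟨s, hs⟩ := by rw [hc]
  rw [smul_apply] at h
  exact h.symm

lemma hasDerivAt_eta (z : UpperHalfPlane) : HasDerivAt ModularForm.eta
    (Real.pi * I / 12 * EisensteinSeries.E2 z * ModularForm.eta z) z := by
  refine (differentiableAt_eta_of_mem_upperHalfPlaneSet z.2).hasDerivAt.congr_deriv ?_
  rw [← logDeriv_eta_eq_E2, logDeriv_apply, div_mul_cancel₀ _ (eta_ne_zero z.2)]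

/-- The cusp form `(θ₂ θ₃ θ₄) ^ 8` is a multiple of `η ^ 24`; compare logarithmic derivatives. -/
lemma E2_eq_thetaLog (z : UpperHalfPlane) :
    EisensteinSeries.E2 z = 3 * thetaLog th2 z - th3 z ^ 4 - th4 z ^ 4 := by
  obtain ⟨c, h⟩ := exists_th_mul_pow_eq_eta
  have hz : 0 < (z : ℂ).im := z.im_pos
  have hl := (((hasDerivAt_th2 hz).fun_mul (hasDerivAt_th3 hz)).fun_mul
    (hasDerivAt_th4 hz)).fun_pow 8
  have hd := hasDerivAt_unique_of_eq hz h hl (((hasDerivAt_eta z).fun_pow 24).const_mul c)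
  have hne : (th2 z * th3 z * th4 z) ^ 8 ≠ 0 := pow_ne_zero _
    (mul_ne_zero (mul_ne_zero (th2_ne_zero hz) (th3_ne_zero hz)) (th4_ne_zero hz))
  refine mul_left_cancel₀ (mul_ne_zero pi_mul_I_ne_zero hne) ?_
  push_cast at hd
  rw [thetaLog_th3 hz, thetaLog_th4 hz] at hd
  linear_combination -hd / 2 + Real.pi * I * EisensteinSeries.E2 z * h z hz

/-- In terms of the level-one Eisenstein series, `4 θ₂' / θ₂` is `(4 E₂(2 t) - E₂(t)) / 3`. -/
lemma three_mul_thetaLog_th2 (z w : UpperHalfPlane) (hw : (w : ℂ) = 2 * z) :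
    3 * thetaLog th2 z = 4 * EisensteinSeries.E2 w - EisensteinSeries.E2 z := by
  have hz : 0 < (z : ℂ).im := z.im_pos
  have hX3 : 4 * th3 (2 * z) ^ 4 = (th3 z ^ 2 + th4 z ^ 2) ^ 2 := by
    rw [th3_sq hz, th4_sq hz]; ring
  rw [E2_eq_thetaLog, E2_eq_thetaLog, hw, th4_two_mul_pow_four hz]
  linear_combination 6 * thetaLog_th2_two_mul hz + hX3

end Discriminant

/-! ### The Lambert series -/

lemma tsum_pnat_coe_mul_pow {x : ℂ} (hx : ‖x‖ < 1) :
    ∑' n : ℕ+, (n : ℂ) * x ^ (n : ℕ) = x / (1 - x) ^ 2 := by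
  rw [← tsum_coe_mul_geometric_of_norm_lt_one hx]
  exact tsum_pnat_eq_tsum_of_eq_zero (f := fun n : ℕ => (n : ℂ) * x ^ n) (by simp)

lemma norm_pow_pnat_lt_one {x : ℂ} (hx : ‖x‖ < 1) (n : ℕ+) : ‖x ^ (n : ℕ)‖ < 1 := by
  rw [norm_pow]
  exact pow_lt_one₀ (norm_nonneg _) hx n.ne_zero

open ArithmeticFunction.sigma in
lemma hasSum_pow_div_one_sub_sq {x : ℂ} (hx : ‖x‖ < 1) :
    HasSum (fun n : ℕ+ => x ^ (n : ℕ) / (1 - x ^ (n : ℕ)) ^ 2)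
      (∑' n : ℕ+, σ 1 n * x ^ (n : ℕ)) := by
  have h (n : ℕ+) : ∑' m : ℕ+, (m : ℂ) ^ 1 * x ^ (n * m : ℕ) =
      x ^ (n : ℕ) / (1 - x ^ (n : ℕ)) ^ 2 := by
    rw [← tsum_pnat_coe_mul_pow (norm_pow_pnat_lt_one hx n)]
    simp only [pow_one, pow_mul]
  have hs := (summable_prod_mul_pow 1 hx).prod
  rw [← tsum_prod_pow_eq_tsum_sigma 1 hx]
  simp only [h] at hs ⊢
  exact hs.hasSum

open ArithmeticFunction.sigma in
/-- Termwise this is `y / (1 + y)² = y / (1 - y)² - 4 y² / (1 - y²)²` for `y = x ^ n`. -/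
lemma tsum_pow_div_one_add_sq {x : ℂ} (hx : ‖x‖ < 1) :
    ∑' n : ℕ+, x ^ (n : ℕ) / (1 + x ^ (n : ℕ)) ^ 2 =
      ∑' n : ℕ+, σ 1 n * x ^ (n : ℕ) - 4 * ∑' n : ℕ+, σ 1 n * (x ^ 2) ^ (n : ℕ) := by
  have hx2 : ‖x ^ 2‖ < 1 := norm_pow_pnat_lt_one hx 2
  rw [← ((hasSum_pow_div_one_sub_sq hx).sub
    ((hasSum_pow_div_one_sub_sq hx2).mul_left 4)).tsum_eq]
  refine tsum_congr fun n => ?_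
  have hn := norm_pow_pnat_lt_one hx n
  rw [← pow_mul, mul_comm 2, pow_mul]
  generalize x ^ (n : ℕ) = y at hn
  have h1 : 1 - y ≠ 0 := fun h => by
    rw [← sub_eq_zero.mp h, norm_one] at hn; exact lt_irrefl _ hn
  have h2 : 1 + y ≠ 0 := fun h => by
    rw [← neg_eq_of_add_eq_zero_right h, norm_neg, norm_one] at hn; exact lt_irrefl _ hn
  have h3 : 1 - y ^ 2 ≠ 0 := by
    rw [show 1 - y ^ 2 = (1 - y) * (1 + y) by ring]; exact mul_ne_zero h1 h2
  rw [show (1 - y ^ 2) ^ 2 = (1 - y) ^ 2 * (1 + y) ^ 2 by ring]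
  field_simp
  ring

lemma norm_q_lt_one (τ : UpperHalfPlane) : ‖q τ‖ < 1 :=
  UpperHalfPlane.norm_exp_two_pi_I_lt_one τ

/-- The Lambert series `KE` is `4 θ₂' / θ₂`: both are `(4 E₂(2 t) - E₂(t)) / 3` at `t = 2 τ`. -/
lemma KE_eq_thetaLog (τ : UpperHalfPlane) : KE τ = thetaLog th2 (2 * τ) := by
  let z : UpperHalfPlane := ⟨2 * τ, im_two_mul_pos τ.im_pos⟩
  let w : UpperHalfPlane := ⟨2 * z, im_two_mul_pos z.im_pos⟩
  have h := three_mul_thetaLog_th2 z w rfl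
  have hq : ‖q τ ^ 2‖ < 1 := norm_pow_pnat_lt_one (norm_q_lt_one τ) 2
  have e1 : cexp (2 * Real.pi * I * z) = q τ ^ 2 := by
    rw [q, ← Complex.exp_nat_mul]; congr 1; simp only [z]; push_cast; ring
  have e2 : cexp (2 * Real.pi * I * w) = (q τ ^ 2) ^ 2 := by
    rw [q, ← Complex.exp_nat_mul, ← Complex.exp_nat_mul]; congr 1; simp only [w, z]; push_cast; ring
  rw [EisensteinSeries.E2_eq_tsum_cexp, EisensteinSeries.E2_eq_tsum_cexp, e1, e2] at h
  change 3 * thetaLog th2 (2 * τ) = _ at h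
  simp only [KE, pow_mul]
  rw [tsum_pow_div_one_add_sq hq]
  linear_combination -h / 3

/-! ### Complete elliptic integrals -/

section EllipticIntegrals

open MeasureTheory

lemma hasDerivAt_sin_sq (t : ℝ) :
    HasDerivAt (fun t => Real.sin t ^ 2) (2 * Real.sin t * Real.cos t) t := by
  simpa using (Real.hasDerivAt_sin t).fun_pow 2

/-- The substitution `x = sin² t`. -/
lemma integral_eq_integral_sin_sq (g : ℝ → ℝ) :
    (1 / 2) * ∫ x in (0 : ℝ)..1, x ^ (-(1 / 2) : ℝ) * (1 - x) ^ (-(1 / 2) : ℝ) * g x =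
      ∫ t in (0 : ℝ)..Real.pi / 2, g (Real.sin t ^ 2) := by
  have hpi := Real.pi_pos
  have hsin {t : ℝ} (ht : t ∈ Set.Ioo 0 (Real.pi / 2)) : 0 < Real.sin t :=
    Real.sin_pos_of_pos_of_lt_pi ht.1 (by linarith [ht.2])
  have hcos {t : ℝ} (ht : t ∈ Set.Ioo 0 (Real.pi / 2)) : 0 < Real.cos t :=
    Real.cos_pos_of_mem_Ioo ⟨by linarith [ht.1], ht.2⟩
  have himage : (fun t => Real.sin t ^ 2) '' Set.Ioo 0 (Real.pi / 2) = Set.Ioo 0 1 := by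
    ext x
    constructor
    · rintro ⟨t, ht, rfl⟩
      have h1 := hsin ht
      have h2 := hcos ht
      have h3 := Real.sin_sq_add_cos_sq t
      exact ⟨by positivity, by nlinarith⟩
    · rintro ⟨h0, h1⟩
      have hs0 : 0 < √x := Real.sqrt_pos.mpr h0
      have hs1 : √x < 1 := by rw [Real.sqrt_lt' one_pos]; simpa using h1
      refine ⟨Real.arcsin √x, ⟨Real.arcsin_pos.mpr hs0, Real.arcsin_lt_pi_div_two.mpr hs1⟩, ?_⟩
      simp only [Real.sin_arcsin (by linarith) hs1.le, Real.sq_sqrt h0.le]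
  have hinj : Set.InjOn (fun t => Real.sin t ^ 2) (Set.Ioo 0 (Real.pi / 2)) := by
    intro s hs t ht h
    have h' : Real.sin s = Real.sin t :=
      (pow_left_inj₀ (hsin hs).le (hsin ht).le two_ne_zero).mp h
    exact Real.injOn_sin ⟨by linarith [hs.1], hs.2.le⟩ ⟨by linarith [ht.1], ht.2.le⟩ h'
  have key := integral_image_eq_integral_abs_deriv_smul (measurableSet_Ioo)
    (fun t _ => (hasDerivAt_sin_sq t).hasDerivWithinAt) hinj
    (fun x => x ^ (-(1 / 2) : ℝ) * (1 - x) ^ (-(1 / 2) : ℝ) * g x)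
  rw [himage] at key
  rw [intervalIntegral.integral_of_le zero_le_one, integral_Ioc_eq_integral_Ioo, key,
    intervalIntegral.integral_of_le (by positivity), integral_Ioc_eq_integral_Ioo,
    ← integral_const_mul]
  refine setIntegral_congr_fun measurableSet_Ioo fun t ht => ?_
  have h1 := hsin ht
  have h2 := hcos ht
  have e1 : 1 - Real.sin t ^ 2 = Real.cos t ^ 2 := by linarith [Real.sin_sq_add_cos_sq t]
  have hr {y : ℝ} (hy : 0 < y) : (y ^ 2) ^ (-(1 / 2) : ℝ) = y⁻¹ := by
    rw [Real.rpow_neg (by positivity), ← Real.sqrt_eq_rpow, Real.sqrt_sq hy.le]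
  simp only [e1, hr h1, hr h2, smul_eq_mul]
  rw [abs_of_pos (by positivity)]
  field_simp

/-- The radicand `1 - α sin² t` of the elliptic integrals. -/
def radicand (α t : ℝ) : ℝ := 1 - α * Real.sin t ^ 2

lemma radicand_pos {α : ℝ} (hα : α < 1) (t : ℝ) : 0 < radicand α t := by
  have h0 := sq_nonneg (Real.sin t)
  have h1 := Real.sin_sq_le_one t
  rw [radicand]
  rcases le_or_gt α 0 with h | h <;> nlinarith

lemma continuous_radicand (α : ℝ) : Continuous (radicand α) := by
  unfold radicand; fun_prop

lemma ellipticK_eq {α : ℝ} (hα : α < 1) :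
    ellipticK α = ∫ t in (0 : ℝ)..Real.pi / 2, (√(radicand α t))⁻¹ := by
  rw [ellipticK, integral_eq_integral_sin_sq fun x => (1 - α * x) ^ (-(1 / 2) : ℝ)]
  refine intervalIntegral.integral_congr fun t _ => ?_
  change radicand α t ^ (-(1 / 2) : ℝ) = _
  rw [Real.rpow_neg (radicand_pos hα t).le, ← Real.sqrt_eq_rpow]

lemma ellipticE_eq (α : ℝ) :
    ellipticE α = ∫ t in (0 : ℝ)..Real.pi / 2, √(radicand α t) := by
  rw [ellipticE, integral_eq_integral_sin_sq fun x => (1 - α * x) ^ ((1 / 2) : ℝ)]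
  refine intervalIntegral.integral_congr fun t _ => ?_
  simp only [← Real.sqrt_eq_rpow]
  rfl

/-- Differentiation under the integral sign in the parameter `α < 1`. For parameters near `α` the
radicand stays in a compact subset of the positive half-line, where `φ'` is bounded. -/
lemma hasDerivAt_integral_radicand {φ φ' : ℝ → ℝ} (hφ : ∀ x, 0 < x → HasDerivAt φ (φ' x) x)
    (hφ' : ContinuousOn φ' (Set.Ioi 0)) {α : ℝ} (hα : α < 1) :
    HasDerivAt (fun a => ∫ t in (0 : ℝ)..Real.pi / 2, φ (radicand a t))
      (∫ t in (0 : ℝ)..Real.pi / 2, φ' (radicand α t) * -Real.sin t ^ 2) α := by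
  have hm : 0 < (1 - α) / 2 := by linarith
  have hm1 : 0 < min 1 ((1 - α) / 2) := lt_min one_pos hm
  obtain ⟨C, hC⟩ := (isCompact_Icc (a := min 1 ((1 - α) / 2))
    (b := 2 + |α|)).exists_bound_of_continuousOn (hφ'.mono fun x hx => hm1.trans_le hx.1)
  have hφc : ContinuousOn φ (Set.Ioi 0) := fun x hx => (hφ x hx).continuousAt.continuousWithinAt
  have hc (a : ℝ) (ha : a < 1) : Continuous fun t => φ (radicand a t) :=
    hφc.comp_continuous (continuous_radicand a) fun t => radicand_pos ha t
  have hc' (a : ℝ) (ha : a < 1) : Continuous fun t => φ' (radicand a t) * -Real.sin t ^ 2 :=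
    (hφ'.comp_continuous (continuous_radicand a) fun t => radicand_pos ha t).mul (by fun_prop)
  have hs : Set.Ioo (α - 1) ((1 + α) / 2) ∈ 𝓝 α := Ioo_mem_nhds (by linarith) (by linarith)
  have hlt {a : ℝ} (ha : a ∈ Set.Ioo (α - 1) ((1 + α) / 2)) : a < 1 := by linarith [ha.2]
  refine (intervalIntegral.hasDerivAt_integral_of_dominated_loc_of_deriv_le (μ := volume)
    (F' := fun a t => φ' (radicand a t) * -Real.sin t ^ 2) (bound := fun _ => C) hs
    (eventually_of_mem hs fun a ha => (hc a (hlt ha)).aestronglyMeasurable)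
    ((hc α hα).intervalIntegrable _ _) (hc' α hα).aestronglyMeasurable
    (ae_of_all _ fun t _ a ha => ?_) intervalIntegrable_const
    (ae_of_all _ fun t _ a ha => ?_)).2
  · have h0 := sq_nonneg (Real.sin t)
    have h1 := Real.sin_sq_le_one t
    have hmem : radicand a t ∈ Set.Icc (min 1 ((1 - α) / 2)) (2 + |α|) := by
      have := ha.1
      have := ha.2
      have := neg_abs_le α
      constructor
      · rw [radicand, min_le_iff]
        rcases le_or_gt a 0 with h | h
        · left; nlinarith
        · right; nlinarith
      · rw [radicand]
        rcases le_or_gt a 0 with h | h <;> nlinarith [abs_nonneg α]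
    have := hC _ hmem
    rw [norm_mul, norm_neg, Real.norm_of_nonneg h0]
    nlinarith [norm_nonneg (φ' (radicand a t))]
  · have : HasDerivAt (fun a => radicand a t) (-Real.sin t ^ 2) a := by
      simpa [radicand] using ((hasDerivAt_id a).mul_const (Real.sin t ^ 2)).const_sub 1
    exact (hφ _ (radicand_pos (hlt ha) t)).comp a this

lemma continuous_sqrt_radicand (α : ℝ) : Continuous fun t => √(radicand α t) :=
  (continuous_radicand α).sqrt

lemma continuous_inv_sqrt_radicand {α : ℝ} (hα : α < 1) :
    Continuous fun t => (√(radicand α t))⁻¹ :=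
  (continuous_sqrt_radicand α).inv₀ fun t => (Real.sqrt_pos.mpr (radicand_pos hα t)).ne'

/-- `∂E/∂α = (E - K) / (2 α)`, with the denominator cleared. -/
lemma exists_hasDerivAt_ellipticE {α : ℝ} (hα : α < 1) :
    ∃ e, HasDerivAt ellipticE e α ∧ 2 * α * e = ellipticE α - ellipticK α := by
  have h := hasDerivAt_integral_radicand (φ := fun x => √x) (φ' := fun x => 1 / (2 * √x))
    (fun x hx => Real.hasDerivAt_sqrt hx.ne')
    (continuousOn_const.div (by fun_prop) fun x hx => by
      have := Real.sqrt_pos.mpr hx; positivity) hα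
  refine ⟨_, h.congr_of_eventuallyEq (.of_forall ellipticE_eq), ?_⟩
  rw [ellipticE_eq, ellipticK_eq hα, ← intervalIntegral.integral_sub
    ((continuous_sqrt_radicand α).intervalIntegrable _ _)
    ((continuous_inv_sqrt_radicand hα).intervalIntegrable _ _),
    ← intervalIntegral.integral_const_mul]
  refine intervalIntegral.integral_congr fun t _ => ?_
  have h0 := Real.sqrt_pos.mpr (radicand_pos hα t)
  have h1 : √(radicand α t) ^ 2 = 1 - α * Real.sin t ^ 2 := Real.sq_sqrt (radicand_pos hα t).le
  field_simp
  linear_combination -h1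

/-- The integral of the derivative of `sin t cos t / √(1 - α sin² t)` over a quarter period
vanishes. -/
lemma integral_inv_sqrt_radicand_cube {α : ℝ} (hα : α < 1) :
    (1 - α) * ∫ t in (0 : ℝ)..Real.pi / 2, (√(radicand α t) ^ 3)⁻¹ = ellipticE α := by
  have hpos (t : ℝ) := Real.sqrt_pos.mpr (radicand_pos hα t)
  have hc3 : Continuous fun t => (√(radicand α t) ^ 3)⁻¹ :=
    ((continuous_sqrt_radicand α).pow 3).inv₀ fun t => (pow_pos (hpos t) 3).ne'
  have hd (t : ℝ) : HasDerivAt (fun t => α * (Real.sin t * Real.cos t / √(radicand α t)))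
      (√(radicand α t) - (1 - α) * (√(radicand α t) ^ 3)⁻¹) t := by
    have hr : HasDerivAt (radicand α) (-(α * (2 * Real.sin t * Real.cos t))) t :=
      ((hasDerivAt_sin_sq t).const_mul α).const_sub 1
    have h := ((((Real.hasDerivAt_sin t).mul (Real.hasDerivAt_cos t)).div
      (hr.sqrt (radicand_pos hα t).ne') (hpos t).ne').const_mul α)
    refine h.congr_deriv ?_
    have h1 : √(radicand α t) ^ 2 = 1 - α * Real.sin t ^ 2 := Real.sq_sqrt (radicand_pos hα t).le
    have h2 := Real.sin_sq_add_cos_sq t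
    have h0 := hpos t
    generalize √(radicand α t) = r at *
    field_simp
    have h3 : Real.cos t ^ 2 = 1 - Real.sin t ^ 2 := by linarith
    have h4 : r ^ 4 = (1 - α * Real.sin t ^ 2) ^ 2 := by rw [← h1]; ring
    rw [h4, h1, Pi.mul_apply]
    linear_combination α * h3
  have := intervalIntegral.integral_eq_sub_of_hasDerivAt (a := 0) (b := Real.pi / 2)
    (fun t _ => hd t)
    (((continuous_sqrt_radicand α).sub (hc3.const_mul (1 - α))).intervalIntegrable _ _)
  rw [intervalIntegral.integral_sub ((continuous_sqrt_radicand α).intervalIntegrable _ _)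
    ((hc3.const_mul (1 - α)).intervalIntegrable _ _), intervalIntegral.integral_const_mul,
    ← ellipticE_eq] at this
  simp only [Real.sin_zero, Real.cos_pi_div_two, zero_mul, mul_zero, zero_div, sub_zero] at this
  linarith

/-- `∂K/∂α = (E - (1 - α) K) / (2 α (1 - α))`, with the denominator cleared. -/
lemma exists_hasDerivAt_ellipticK {α : ℝ} (hα : α < 1) :
    ∃ k, HasDerivAt ellipticK k α ∧
      2 * α * (1 - α) * k = ellipticE α - (1 - α) * ellipticK α := by
  have hpos (t : ℝ) := Real.sqrt_pos.mpr (radicand_pos hα t)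
  have h := hasDerivAt_integral_radicand (φ := fun x => (√x)⁻¹)
    (φ' := fun x => -(1 / (2 * √x)) / √x ^ 2)
    (fun x hx => (Real.hasDerivAt_sqrt hx.ne').inv (Real.sqrt_pos.mpr hx).ne')
    (by
      refine ContinuousOn.div (ContinuousOn.neg (continuousOn_const.div (by fun_prop) ?_))
        (by fun_prop) ?_ <;> intro x hx <;> have := Real.sqrt_pos.mpr hx <;> positivity) hα
  refine ⟨_, h.congr_of_eventuallyEq ?_, ?_⟩
  · filter_upwards [Iio_mem_nhds hα] with a ha using ellipticK_eq ha
  have hc3 : Continuous fun t => (√(radicand α t) ^ 3)⁻¹ :=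
    ((continuous_sqrt_radicand α).pow 3).inv₀ fun t => (pow_pos (hpos t) 3).ne'
  rw [← integral_inv_sqrt_radicand_cube hα, ellipticK_eq hα, ← mul_sub,
    ← intervalIntegral.integral_sub (hc3.intervalIntegrable _ _)
    ((continuous_inv_sqrt_radicand hα).intervalIntegrable _ _), mul_comm (2 * α) (1 - α), mul_assoc,
    ← intervalIntegral.integral_const_mul]
  congr 1
  refine intervalIntegral.integral_congr fun t _ => ?_
  have h0 := hpos t
  have h1 : √(radicand α t) ^ 2 = 1 - α * Real.sin t ^ 2 := Real.sq_sqrt (radicand_pos hα t).le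
  field_simp
  linear_combination h1

lemma ellipticK_zero : ellipticK 0 = Real.pi / 2 := by
  simp [ellipticK_eq zero_lt_one, radicand]

lemma ellipticE_zero : ellipticE 0 = Real.pi / 2 := by
  simp [ellipticE_eq, radicand]

lemma ellipticK_pos {α : ℝ} (hα : α < 1) : 0 < ellipticK α := by
  rw [ellipticK_eq hα]
  exact intervalIntegral.intervalIntegral_pos_of_pos
    ((continuous_inv_sqrt_radicand hα).intervalIntegrable _ _)
    (fun t => inv_pos.mpr (Real.sqrt_pos.mpr (radicand_pos hα t))) (by positivity)

end EllipticIntegrals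

/-! ### The imaginary axis -/

lemma im_I_mul_pos {s : ℝ} (hs : 0 < s) : 0 < (I * (s : ℂ)).im := by simpa using hs

lemma tendsto_I_mul : Tendsto (fun s : ℝ => I * (s : ℂ)) atTop imTop :=
  tendsto_comap_iff.mpr (by simpa [Function.comp_def] using! tendsto_id)

lemma hasDerivAt_comp_I_mul {f : ℂ → ℂ} {d : ℂ} {s : ℝ} (hf : HasDerivAt f d (I * s)) :
    HasDerivAt (fun s : ℝ => f (I * s)) (I * d) s := by
  have h : HasDerivAt (fun z : ℂ => f (I * z)) (d * (I * 1)) s :=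
    hf.comp (s : ℂ) ((hasDerivAt_id (s : ℂ)).const_mul I)
  exact h.comp_ofReal.congr_deriv (by ring)

lemma hasDerivAt_re_I_mul {f : ℂ → ℂ} {d : ℂ} {s : ℝ} (hf : HasDerivAt f d (I * s)) :
    HasDerivAt (fun s : ℝ => (f (I * s)).re) (I * d).re s :=
  (reCLM.hasFDerivAt.comp_hasDerivAt s (hasDerivAt_comp_I_mul hf) :)

lemma hasDerivAt_im_I_mul {f : ℂ → ℂ} {d : ℂ} {s : ℝ} (hf : HasDerivAt f d (I * s)) :
    HasDerivAt (fun s : ℝ => (f (I * s)).im) (I * d).im s :=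
  (imCLM.hasFDerivAt.comp_hasDerivAt s (hasDerivAt_comp_I_mul hf) :)

lemma neg_conj_I_mul (s : ℝ) : -(starRingEnd ℂ) (I * s) = I * s := by
  simp

lemma th3_im {s : ℝ} : (th3 (I * s)).im = 0 := by
  rw [← conj_eq_iff_im, th3, jacobiTheta₂_conj, neg_conj_I_mul, map_zero]

lemma th4_im {s : ℝ} : (th4 (I * s)).im = 0 := by
  rw [← conj_eq_iff_im, th4, jacobiTheta₂_conj, neg_conj_I_mul]
  simp [map_ofNat]

lemma th2_im {s : ℝ} : (th2 (I * s)).im = 0 := by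
  rw [← conj_eq_iff_im, th2, map_mul, jacobiTheta₂_conj, neg_conj_I_mul, ← Complex.exp_conj]
  have h1 : (starRingEnd ℂ) (I * s / 2) = -(I * s / 2) := by
    simp [neg_div, map_ofNat]
  have h2 : (starRingEnd ℂ) (Real.pi * I * (I * s) / 4) = Real.pi * I * (I * s) / 4 := by
    simp [map_ofNat]
  rw [h1, h2, jacobiTheta₂_neg_left]

/-- The theta constant `θ₂` on the imaginary axis `t = i s`, a real function. -/
def r2 (s : ℝ) : ℝ := (th2 (I * s)).re

/-- The theta constant `θ₃` on the imaginary axis `t = i s`, a real function. -/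
def r3 (s : ℝ) : ℝ := (th3 (I * s)).re

/-- The theta constant `θ₄` on the imaginary axis `t = i s`, a real function. -/
def r4 (s : ℝ) : ℝ := (th4 (I * s)).re

/-- The function `P = 4 θ₂' / θ₂` on the imaginary axis `t = i s`, a real function. -/
def rP (s : ℝ) : ℝ := (thetaLog th2 (I * s)).re

lemma ofReal_r2 (s : ℝ) : (r2 s : ℂ) = th2 (I * s) := Complex.ext rfl (by simp [th2_im])

lemma ofReal_r3 (s : ℝ) : (r3 s : ℂ) = th3 (I * s) := Complex.ext rfl (by simp [th3_im])

lemma ofReal_r4 (s : ℝ) : (r4 s : ℂ) = th4 (I * s) := Complex.ext rfl (by simp [th4_im])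

section

variable {s : ℝ}

lemma r2_ne_zero (hs : 0 < s) : r2 s ≠ 0 := by
  have := th2_ne_zero (im_I_mul_pos hs)
  rwa [← ofReal_r2, ofReal_ne_zero] at this

lemma r3_ne_zero (hs : 0 < s) : r3 s ≠ 0 := by
  have := th3_ne_zero (im_I_mul_pos hs)
  rwa [← ofReal_r3, ofReal_ne_zero] at this

lemma r4_ne_zero (hs : 0 < s) : r4 s ≠ 0 := by
  have := th4_ne_zero (im_I_mul_pos hs)
  rwa [← ofReal_r4, ofReal_ne_zero] at this

lemma r2_pow_four (hs : 0 < s) : r2 s ^ 4 = r3 s ^ 4 - r4 s ^ 4 := by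
  have := th2_pow_four (im_I_mul_pos hs)
  rw [← ofReal_r2, ← ofReal_r3, ← ofReal_r4] at this
  exact_mod_cast this

lemma ofReal_rP (hs : 0 < s) : (rP s : ℂ) = thetaLog th2 (I * s) := by
  refine Complex.ext rfl ?_
  -- `θ₂` is real on the axis, so the imaginary part of its derivative along the axis vanishes
  have h := hasDerivAt_im_I_mul (hasDerivAt_th2 (im_I_mul_pos hs))
  simp only [th2_im] at h
  have h0 := h.unique (hasDerivAt_const s (0 : ℝ))
  rw [← ofReal_r2, show I * (Real.pi * I / 4 * (thetaLog th2 (I * s) * r2 s)) =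
    ((-(Real.pi / 4) * r2 s : ℝ) : ℂ) * thetaLog th2 (I * s) by
      push_cast; linear_combination Real.pi / 4 * thetaLog th2 (I * s) * r2 s * I_sq,
    im_ofReal_mul] at h0
  have h1 : -(Real.pi / 4) * r2 s ≠ 0 :=
    mul_ne_zero (neg_ne_zero.mpr (div_ne_zero Real.pi_ne_zero four_ne_zero)) (r2_ne_zero hs)
  rw [ofReal_im, (mul_eq_zero.mp h0).resolve_left h1]

lemma hasDerivAt_r2 (hs : 0 < s) : HasDerivAt r2 (-(Real.pi / 4) * (rP s * r2 s)) s := by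
  refine (hasDerivAt_re_I_mul (hasDerivAt_th2 (im_I_mul_pos hs))).congr_deriv ?_
  rw [← ofReal_r2, ← ofReal_rP hs, ← ofReal_re (-(Real.pi / 4) * (rP s * r2 s))]
  congr 1
  push_cast
  linear_combination Real.pi / 4 * rP s * r2 s * I_sq

lemma hasDerivAt_r3 (hs : 0 < s) :
    HasDerivAt r3 (-(Real.pi / 4) * ((rP s - r4 s ^ 4) * r3 s)) s := by
  refine (hasDerivAt_re_I_mul (hasDerivAt_th3 (im_I_mul_pos hs))).congr_deriv ?_
  rw [thetaLog_th3 (im_I_mul_pos hs), ← ofReal_r3, ← ofReal_r4, ← ofReal_rP hs,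
    ← ofReal_re (-(Real.pi / 4) * ((rP s - r4 s ^ 4) * r3 s))]
  congr 1
  push_cast
  linear_combination Real.pi / 4 * (rP s - r4 s ^ 4) * r3 s * I_sq

lemma deriv_thetaLog_th2 {t : ℂ} (ht : 0 < t.im) : deriv (thetaLog th2) t =
    Real.pi * I / 2 * (thetaLog th2 t ^ 2 - th3 t ^ 4 * th4 t ^ 4) := by
  have h := riccatiDefect_eq_zero ht
  have hp := pi_mul_I_ne_zero
  rw [riccatiDefect] at h
  field_simp at h
  linear_combination h / 2

lemma hasDerivAt_rP (hs : 0 < s) :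
    HasDerivAt rP (-(Real.pi / 2) * (rP s ^ 2 - r3 s ^ 4 * r4 s ^ 4)) s := by
  refine (hasDerivAt_re_I_mul
    (differentiableAt_thetaLog_th2 (im_I_mul_pos hs)).hasDerivAt).congr_deriv ?_
  rw [deriv_thetaLog_th2 (im_I_mul_pos hs), ← ofReal_r3, ← ofReal_r4, ← ofReal_rP hs,
    ← ofReal_re (-(Real.pi / 2) * (rP s ^ 2 - r3 s ^ 4 * r4 s ^ 4))]
  congr 1
  push_cast
  linear_combination Real.pi / 2 * (rP s ^ 2 - r3 s ^ 4 * r4 s ^ 4) * I_sq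

end

lemma tendsto_re_I_mul {f : ℂ → ℂ} {c : ℂ} (hf : Tendsto f imTop (𝓝 c)) :
    Tendsto (fun s : ℝ => (f (I * s)).re) atTop (𝓝 c.re) :=
  (continuous_re.tendsto c).comp (hf.comp tendsto_I_mul)

lemma tendsto_r3 : Tendsto r3 atTop (𝓝 1) :=
  tendsto_re_I_mul (tendsto_of_sub_isBigO_nome th3_isBigO)

lemma tendsto_r4 : Tendsto r4 atTop (𝓝 1) :=
  tendsto_re_I_mul (tendsto_of_sub_isBigO_nome th4_isBigO)

lemma tendsto_rP : Tendsto rP atTop (𝓝 1) :=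
  tendsto_re_I_mul (tendsto_of_sub_isBigO_nome thetaLog_th2_isBigO)

/-! ### The parameter as a function of the nome -/

/-- The parameter `α = k²` of the elliptic integrals with nome `exp (-π s)`. -/
def param (s : ℝ) : ℝ := r2 s ^ 4 / r3 s ^ 4

section

variable {s : ℝ}

lemma one_sub_param (hs : 0 < s) : 1 - param s = r4 s ^ 4 / r3 s ^ 4 := by
  have := r3_ne_zero hs
  rw [param, r2_pow_four hs]
  field_simp
  ring

lemma param_lt_one (hs : 0 < s) : param s < 1 := by
  have h3 := r3_ne_zero hs
  have h4 := r4_ne_zero hs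
  have : 0 < 1 - param s := by rw [one_sub_param hs]; positivity
  linarith

lemma hasDerivAt_param (hs : 0 < s) : HasDerivAt param (-Real.pi * (r4 s ^ 4 * param s)) s := by
  have h3 := r3_ne_zero hs
  refine (((hasDerivAt_r2 hs).fun_pow 4).div ((hasDerivAt_r3 hs).fun_pow 4)
    (pow_ne_zero 4 h3)).congr_deriv ?_
  rw [param]
  push_cast
  field_simp
  ring

lemma neg_one_div_I_mul (s : ℝ) : -1 / (I * (s : ℂ)) = I * ((s⁻¹ : ℝ) : ℂ) := by
  push_cast
  rw [div_eq_mul_inv, mul_inv, inv_I]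
  ring

lemma cpow_half_sq (s : ℝ) : ((-I * (I * (s : ℂ))) ^ (1 / 2 : ℂ)) ^ 2 = s := by
  rw [← cpow_nat_mul]
  norm_num
  rw [← mul_assoc, I_mul_I]
  ring

lemma r3_inv_sq (hs : 0 < s) : r3 s⁻¹ ^ 2 = s * r3 s ^ 2 := by
  have h := th3_neg_inv (im_I_mul_pos hs)
  rw [neg_one_div_I_mul, ← ofReal_r3, ← ofReal_r3] at h
  have : (r3 s⁻¹ : ℂ) ^ 2 = s * r3 s ^ 2 := by rw [h, mul_pow, cpow_half_sq]
  exact_mod_cast this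

lemma r2_inv_sq (hs : 0 < s) : r2 s⁻¹ ^ 2 = s * r4 s ^ 2 := by
  have h := th2_neg_inv (im_I_mul_pos hs)
  rw [neg_one_div_I_mul, ← ofReal_r2, ← ofReal_r4] at h
  have : (r2 s⁻¹ : ℂ) ^ 2 = s * r4 s ^ 2 := by rw [h, mul_pow, cpow_half_sq]
  exact_mod_cast this

lemma param_inv (hs : 0 < s) : param s⁻¹ = 1 - param s := by
  have h3 := r3_ne_zero hs
  rw [one_sub_param hs, param, show 4 = 2 * 2 from rfl, pow_mul, pow_mul (r3 _), r2_inv_sq hs,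
    r3_inv_sq hs]
  field_simp
  ring

end

lemma tendsto_param : Tendsto param atTop (𝓝 0) := by
  have h := (((tendsto_r3.pow 4).sub (tendsto_r4.pow 4)).div (tendsto_r3.pow 4) (by norm_num))
  norm_num at h
  refine h.congr' ?_
  filter_upwards [eventually_gt_atTop 0] with s hs
  rw [Pi.div_apply, param, r2_pow_four hs]

/-- Every parameter strictly between `0` and `1` comes from a nome. -/
lemma exists_param_eq {α : ℝ} (hα : α ∈ Set.Ioo (0 : ℝ) 1) : ∃ s, 0 < s ∧ param s = α := by
  obtain ⟨s, h1, hs⟩ := ((tendsto_param.eventually_lt_const hα.1).and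
    (eventually_gt_atTop 0)).exists
  obtain ⟨u, h2, hu⟩ := ((tendsto_param.eventually_lt_const (sub_pos.mpr hα.2)).and
    (eventually_gt_atTop 0)).exists
  have h3 : α < param u⁻¹ := by rw [param_inv hu]; linarith
  obtain ⟨x, hx, hxα⟩ := isPreconnected_Ioi.intermediate_value (s := Set.Ioi (0 : ℝ)) hs
    (inv_pos.mpr hu) (fun x hx => (hasDerivAt_param hx).continuousAt.continuousWithinAt)
    ⟨h1.le, h3.le⟩
  exact ⟨x, hx, hxα⟩

/-! ### Theta constants and elliptic integrals -/

lemma eq_of_hasDerivAt_zero_of_tendsto {f : ℝ → ℝ} {c : ℝ} (hf : ∀ s, 0 < s → HasDerivAt f 0 s)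
    (hc : Tendsto f atTop (𝓝 c)) {s : ℝ} (hs : 0 < s) : f s = c := by
  refine tendsto_nhds_unique (tendsto_const_nhds.congr' ?_) hc
  filter_upwards [eventually_gt_atTop 0] with x hx
  exact isOpen_Ioi.is_const_of_deriv_eq_zero (s := Set.Ioi (0 : ℝ)) isPreconnected_Ioi
    (fun x hx => (hf x hx).differentiableAt.differentiableWithinAt) (fun x hx => (hf x hx).deriv)
    hs hx

lemma tendsto_ellipticK_param : Tendsto (fun s => ellipticK (param s)) atTop (𝓝 (Real.pi / 2)) := by
  obtain ⟨k, hk, -⟩ := exists_hasDerivAt_ellipticK zero_lt_one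
  rw [← ellipticK_zero]
  exact hk.continuousAt.tendsto.comp tendsto_param

lemma tendsto_ellipticE_param : Tendsto (fun s => ellipticE (param s)) atTop (𝓝 (Real.pi / 2)) := by
  obtain ⟨e, he, -⟩ := exists_hasDerivAt_ellipticE zero_lt_one
  rw [← ellipticE_zero]
  exact he.continuousAt.tendsto.comp tendsto_param

section

variable {s : ℝ}

/-- The equation for `∂K/∂α` along the imaginary axis. The factor `1 - α = θ₄⁴ / θ₃⁴` cancels the
singular denominator. -/
lemma hasDerivAt_ellipticK_param (hs : 0 < s) : HasDerivAt (fun s => ellipticK (param s))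
    (-(Real.pi / 2) * (r3 s ^ 4 * ellipticE (param s) - r4 s ^ 4 * ellipticK (param s))) s := by
  obtain ⟨k, hk, hk'⟩ := exists_hasDerivAt_ellipticK (param_lt_one hs)
  refine (hk.comp s (hasDerivAt_param hs)).congr_deriv ?_
  have h3 := r3_ne_zero hs
  have h1 : (1 - param s) * r3 s ^ 4 = r4 s ^ 4 := by
    rw [one_sub_param hs]; field_simp
  linear_combination -(Real.pi / 2) * r3 s ^ 4 * hk' +
    Real.pi / 2 * (2 * param s * k + ellipticK (param s)) * h1

lemma hasDerivAt_ellipticE_param (hs : 0 < s) : HasDerivAt (fun s => ellipticE (param s))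
    (-(Real.pi / 2) * (r4 s ^ 4 * (ellipticE (param s) - ellipticK (param s)))) s := by
  obtain ⟨e, he, he'⟩ := exists_hasDerivAt_ellipticE (param_lt_one hs)
  refine (he.comp s (hasDerivAt_param hs)).congr_deriv ?_
  linear_combination -(Real.pi / 2) * r4 s ^ 4 * he'

/-- Both `(K, E)` and `(θ₃², P / θ₃²)` solve the same linear system of rank two along the imaginary
axis. Their Wronskian `K P / θ₃² - E θ₃²` is constant, and it vanishes at the cusp. -/
lemma ellipticK_mul_rP (hs : 0 < s) :
    ellipticK (param s) * rP s = ellipticE (param s) * r3 s ^ 4 := by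
  have hd (s : ℝ) (hs : 0 < s) : HasDerivAt (fun s => ellipticK (param s) * rP s / r3 s ^ 2 -
      ellipticE (param s) * r3 s ^ 2) 0 s := by
    have h3 := r3_ne_zero hs
    have hy := (hasDerivAt_r3 hs).fun_pow 2
    refine ((((hasDerivAt_ellipticK_param hs).fun_mul (hasDerivAt_rP hs)).fun_div hy
      (pow_ne_zero 2 h3)).fun_sub ((hasDerivAt_ellipticE_param hs).fun_mul hy)).congr_deriv ?_
    push_cast
    field_simp
    ring
  have hlim := ((tendsto_ellipticK_param.mul tendsto_rP).div (tendsto_r3.pow 2) (by norm_num)).sub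
    (tendsto_ellipticE_param.mul (tendsto_r3.pow 2))
  norm_num at hlim
  have h := eq_of_hasDerivAt_zero_of_tendsto hd hlim hs
  have h3 := r3_ne_zero hs
  field_simp at h
  linear_combination h

/-- `K = (π / 2) θ₃²`: the quotient of the two sides is constant because the Wronskian vanishes. -/
lemma ellipticK_param (hs : 0 < s) : ellipticK (param s) = Real.pi / 2 * r3 s ^ 2 := by
  have hd (s : ℝ) (hs : 0 < s) : HasDerivAt (fun s => ellipticK (param s) / r3 s ^ 2) 0 s := by
    have h3 := r3_ne_zero hs
    refine ((hasDerivAt_ellipticK_param hs).fun_div ((hasDerivAt_r3 hs).fun_pow 2)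
      (pow_ne_zero 2 h3)).congr_deriv ?_
    have h := ellipticK_mul_rP hs
    push_cast
    field_simp
    linear_combination 4 * Real.pi * h
  have hlim := tendsto_ellipticK_param.div (tendsto_r3.pow 2) (by norm_num)
  norm_num at hlim
  have h := eq_of_hasDerivAt_zero_of_tendsto hd hlim hs
  have h3 := r3_ne_zero hs
  rw [div_eq_iff (pow_ne_zero 2 h3)] at h
  exact h

/-- The inversion `s ↦ 1 / s` exchanges complementary parameters, so that `s` is the ratio of the
complementary periods. -/
lemma ellipticK_one_sub_param (hs : 0 < s) :
    ellipticK (1 - param s) = s * ellipticK (param s) := by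
  rw [← param_inv hs, ellipticK_param (inv_pos.mpr hs), ellipticK_param hs, r3_inv_sq hs]
  ring

/-- Since `K = (π / 2) θ₃²`, the vanishing of the Wronskian gives `E = (π / 2) P / θ₃²`. -/
lemma normK_mul_normE_param (hs : 0 < s) : normK (param s) * normE (param s) = rP s := by
  have h := ellipticK_mul_rP hs
  have h3 := r3_ne_zero hs
  have hpi := Real.pi_ne_zero
  rw [normK, normE]
  rw [ellipticK_param hs] at h ⊢
  have hE : ellipticE (param s) = Real.pi / 2 * rP s / r3 s ^ 2 := by
    field_simp
    field_simp at h
    linear_combination -h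
  rw [hE]
  field_simp

end

/-- For `α = θ₂⁴ / θ₃⁴` at `t = i s` the witness is `τ = i s / 2`. -/
lemma KE_eq_normK_mul_normE {α : ℝ} (hα : α ∈ Set.Ioo (0 : ℝ) 1) : ∃ τ : UpperHalfPlane,
    (τ : ℂ) = I * (ellipticK (1 - α) : ℂ) / (2 * (ellipticK α : ℂ)) ∧
      KE τ = (normK α : ℂ) * (normE α : ℂ) := by
  obtain ⟨s, hs, rfl⟩ := exists_param_eq hα
  have hK : (ellipticK (param s) : ℂ) ≠ 0 := ofReal_ne_zero.mpr (ellipticK_pos hα.2).ne'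
  have him : 0 < (I * (s : ℂ) / 2).im := by
    have : I * (s : ℂ) / 2 = ((s / 2 : ℝ) : ℂ) * I := by push_cast; ring
    rw [this, im_ofReal_mul, I_im]
    linarith
  refine ⟨⟨I * s / 2, him⟩, ?_, ?_⟩
  · change I * (s : ℂ) / 2 = _
    rw [ellipticK_one_sub_param hs]
    push_cast
    field_simp
  · rw [KE_eq_thetaLog, ← ofReal_mul, normK_mul_normE_param hs, ofReal_rP hs]
    congr 1
    change 2 * (I * (s : ℂ) / 2) = _
    ring

/-! ### The differential system -/

lemma theta3_eq (τ : UpperHalfPlane) : theta3 τ = th3 (2 * τ) := by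
  rw [theta3, th3, jacobiTheta₂]
  refine tsum_congr fun m => ?_
  rw [q, ← Complex.exp_int_mul, jacobiTheta₂_term]
  congr 1
  push_cast
  ring

lemma theta4_eq (τ : UpperHalfPlane) : theta4 τ = th4 (2 * τ) := by
  rw [theta4, th4, jacobiTheta₂]
  refine tsum_congr fun m => ?_
  rw [q, ← Complex.exp_int_mul, jacobiTheta₂_term, ← Complex.exp_pi_mul_I, ← Complex.exp_int_mul,
    ← Complex.exp_add]
  congr 1
  push_cast
  ring

lemma theta2_eq (τ : UpperHalfPlane) : theta2 τ = th2 (2 * τ) := by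
  rw [theta2, th2, jacobiTheta₂, ← tsum_mul_left]
  refine tsum_congr fun m => ?_
  rw [jacobiTheta₂_term, ← Complex.exp_add]
  congr 1
  ring

lemma mdifferentiable_of_eq_two_mul {f : UpperHalfPlane → ℂ} {F : ℂ → ℂ}
    (h : ∀ τ : UpperHalfPlane, f τ = F (2 * τ))
    (hF : ∀ t : ℂ, 0 < t.im → DifferentiableAt ℂ F t) : MDifferentiable 𝓘(ℂ) 𝓘(ℂ) f := by
  rw [UpperHalfPlane.mdifferentiable_iff]
  refine DifferentiableOn.congr (f := fun t => F (2 * t)) (fun t ht =>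
    ((hF (2 * t) (im_two_mul_pos ht)).comp t (by fun_prop)).differentiableWithinAt) fun t ht => ?_
  simp [h, UpperHalfPlane.ofComplex_apply_of_im_pos ht]

lemma qderiv_eq {f : UpperHalfPlane → ℂ} {F : ℂ → ℂ} (h : ∀ τ : UpperHalfPlane, f τ = F (2 * τ))
    {τ : UpperHalfPlane} {d : ℂ} (hF : HasDerivAt F d (2 * τ)) :
    qderiv f τ = (Real.pi * I)⁻¹ * d := by
  have h1 : HasDerivAt (fun t : ℂ => F (2 * t)) (d * (2 * 1)) (τ : ℂ) :=
    hF.comp (τ : ℂ) ((hasDerivAt_id (τ : ℂ)).const_mul 2)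
  have h2 : f ∘ UpperHalfPlane.ofComplex =ᶠ[𝓝 (τ : ℂ)] fun t => F (2 * t) :=
    (eventually_im_pos τ.im_pos).mono fun t ht => by
      simp [h, UpperHalfPlane.ofComplex_apply_of_im_pos ht]
  have hp := pi_mul_I_ne_zero
  rw [qderiv, Derivative.normalizedDerivOfComplex, (h1.congr_of_eventuallyEq h2).deriv]
  field_simp

lemma four_mul_qderiv_div {f : UpperHalfPlane → ℂ} {F : ℂ → ℂ}
    (h : ∀ τ : UpperHalfPlane, f τ = F (2 * τ)) {τ : UpperHalfPlane}
    (hF : HasDerivAt F (Real.pi * I / 4 * (thetaLog F (2 * τ) * F (2 * τ))) (2 * τ))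
    (h0 : F (2 * τ) ≠ 0) : 4 * qderiv f τ / f τ = thetaLog F (2 * τ) := by
  have hp := pi_mul_I_ne_zero
  rw [qderiv_eq h hF, h]
  field_simp

end

end ThetaKE

open ThetaKE

theorem mainTheorem6 :
    -- the four functions are holomorphic on the upper half-plane
    (MDifferentiable 𝓘(ℂ) 𝓘(ℂ) ThetaKE.theta2 ∧
      MDifferentiable 𝓘(ℂ) 𝓘(ℂ) ThetaKE.theta3 ∧
      MDifferentiable 𝓘(ℂ) 𝓘(ℂ) ThetaKE.theta4 ∧
      MDifferentiable 𝓘(ℂ) 𝓘(ℂ) ThetaKE.KE) ∧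
    -- `KE` is the product of the normalized elliptic integrals as a function of the nome
    (∀ α ∈ Set.Ioo (0 : ℝ) 1, ∃ τ : UpperHalfPlane,
      (τ : ℂ) = I * (ThetaKE.ellipticK (1 - α) : ℂ) / (2 * (ThetaKE.ellipticK α : ℂ)) ∧
      ThetaKE.KE τ = (ThetaKE.normK α : ℂ) * (ThetaKE.normE α : ℂ)) ∧
    -- the differential system
    (∀ τ : UpperHalfPlane,
      ThetaKE.theta2 τ ≠ 0 ∧ ThetaKE.theta3 τ ≠ 0 ∧ ThetaKE.theta4 τ ≠ 0 ∧
      4 * ThetaKE.qderiv ThetaKE.theta2 τ / ThetaKE.theta2 τ = ThetaKE.KE τ ∧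
      4 * ThetaKE.qderiv ThetaKE.theta3 τ / ThetaKE.theta3 τ =
        ThetaKE.KE τ - ThetaKE.theta4 τ ^ 4 ∧
      4 * ThetaKE.qderiv ThetaKE.theta4 τ / ThetaKE.theta4 τ =
        ThetaKE.KE τ - ThetaKE.theta3 τ ^ 4 ∧
      2 * ThetaKE.qderiv ThetaKE.KE τ =
        ThetaKE.KE τ ^ 2 - ThetaKE.theta3 τ ^ 4 * ThetaKE.theta4 τ ^ 4) := by
  refine ⟨⟨mdifferentiable_of_eq_two_mul theta2_eq fun _ => differentiableAt_th2,
    mdifferentiable_of_eq_two_mul theta3_eq fun _ => differentiableAt_th3,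
    mdifferentiable_of_eq_two_mul theta4_eq fun _ => differentiableAt_th4,
    mdifferentiable_of_eq_two_mul KE_eq_thetaLog fun _ => differentiableAt_thetaLog_th2⟩,
    fun α hα => KE_eq_normK_mul_normE hα, fun τ => ?_⟩
  have ht : 0 < (2 * (τ : ℂ)).im := im_two_mul_pos τ.im_pos
  have h2 := th2_ne_zero ht
  have h3 := th3_ne_zero ht
  have h4 := th4_ne_zero ht
  refine ⟨by rwa [theta2_eq], by rwa [theta3_eq], by rwa [theta4_eq], ?_, ?_, ?_, ?_⟩
  · rw [four_mul_qderiv_div theta2_eq (hasDerivAt_th2 ht) h2, KE_eq_thetaLog]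
  · rw [four_mul_qderiv_div theta3_eq (hasDerivAt_th3 ht) h3, KE_eq_thetaLog, theta4_eq,
      thetaLog_th3 ht]
  · rw [four_mul_qderiv_div theta4_eq (hasDerivAt_th4 ht) h4, KE_eq_thetaLog, theta3_eq,
      thetaLog_th4 ht]
  · have hp := pi_mul_I_ne_zero
    rw [qderiv_eq KE_eq_thetaLog (differentiableAt_thetaLog_th2 ht).hasDerivAt,
      deriv_thetaLog_th2 ht, KE_eq_thetaLog, theta3_eq, theta4_eq]
    field_simp
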